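/- **Proposition.** Let $d\ge 2$, let $\mathbb H^d$ be $d$-dimensional hyperbolic space (curvature $-1$), let $\lambda\in[0,1]$, $R>0$ and $s\in\mathbb R$, and let $B_R^d$ be the closed ball of radius $R$ around a point $\mathbf o\in\mathbb H^d$. Let $H(s)\subset\mathbb H^d$ be a $\lambda$-geodesic hyperplane, i.e. a connected, complete, totally umbilic hypersurface of constant normal curvature $\lambda$ (with respect to a suitable unit normal field), whose signed distance from $\mathbf o$ equals $s$. Here the signed distance is $\operatorname{dist}(\mathbf o,H)$ if $\mathbf o$ lies on the convex side of $H$ and $-\operatorname{dist}(\mathbf o,H)$ otherwise, where the convex side is the geodesically convex one of the two components of $\mathbb H^d\setminus H$ (for $\lambda=0$ both components are convex, and either one may be chosen). Then $H(s)\cap B_R^d$ is non-empty if and only if $|s|\le R$. If $|s|\le R$, it is a closed ball for the intrinsic (Riemannian) distance of $H(s)$, and its $(d-1)$-dimensional hyperbolic Hausdorff measure is given as follows, where $\kappa_k$ and $\omega_k=k\kappa_k$ denote the volume and the surface area of the unit ball of $\mathbb R^k$. 1. If $\lambda=1$, then $$\mathcal H^{d-1}(H(s)\cap B_R^d)=\kappa_{d-1}\bigl[2e^{s}(\cosh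 R-\cosh s)\bigr]^{\frac{d-1}{2}}.$$ 2. If $0\le\lambda<1$, put $\mu=\sqrt{1-\lambda^2}$ and $\Delta=\operatorname{artanh}\lambda$. Then $$\mathcal H^{d-1}(H(s)\cap B_R^d)=\frac{\omega_{d-1}}{\mu^{d-1}}\int_0^{\rho(s;R)}\sinh^{d-2}u\,\mathrm du,\qquad \rho(s;R)=\operatorname{arcosh}\frac{\cosh R-\sinh\Delta\,\sinh(s-\Delta)}{\cosh\Delta\,\cosh(s-\Delta)}.$$ The Hausdorff measure is normalized so that on $\mathbb R^{d-1}$ it is Lebesgue measure. -/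

import Mathlib

open Set Filter Topology MeasureTheory
open scoped ContDiff ENNReal

noncomputable section

namespace Hyperbolic

/-! ### The hyperboloid model of hyperbolic space -/

/-- Minkowski space `ℝ^{1,d}`: the first factor is the time coordinate. -/
abbrev Mink (d : ℕ) : Type := ℝ × EuclideanSpace ℝ (Fin d)

/-- The Lorentzian inner product of signature `(d, 1)`. -/
def mink {d : ℕ} (x y : Mink d) : ℝ := inner ℝ x.2 y.2 - x.1 * y.1

/-- `d`-dimensional hyperbolic space of curvature `-1`, as the upper sheet of the hyperboloid
`⟨x, x⟩ = -1` in Minkowski space. -/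
@[ext]
structure HypSpace (d : ℕ) where
  /-- the position vector in Minkowski space -/
  vec : Mink d
  mink_self : mink vec vec = -1
  pos : 0 < vec.1

variable {d : ℕ}

theorem mink_comm (x y : Mink d) : mink x y = mink y x := by
  simp only [mink, real_inner_comm, mul_comm]

theorem mink_sub_left (x y z : Mink d) : mink (x - y) z = mink x z - mink y z := by
  simp only [mink, Prod.fst_sub, Prod.snd_sub, inner_sub_left]
  ring

theorem mink_add_left (x y z : Mink d) : mink (x + y) z = mink x z + mink y z := by
  simp only [mink, Prod.fst_add, Prod.snd_add, inner_add_left]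
  ring

theorem mink_smul_left (r : ℝ) (x y : Mink d) : mink (r • x) y = r * mink x y := by
  simp only [mink, Prod.smul_fst, Prod.smul_snd, real_inner_smul_left, smul_eq_mul]
  ring

theorem mink_sub_right (x y z : Mink d) : mink x (y - z) = mink x y - mink x z := by
  rw [mink_comm, mink_sub_left, mink_comm y, mink_comm z]

theorem mink_add_right (x y z : Mink d) : mink x (y + z) = mink x y + mink x z := by
  rw [mink_comm, mink_add_left, mink_comm y, mink_comm z]

theorem mink_smul_right (r : ℝ) (x y : Mink d) : mink x (r • y) = r * mink x y := by
  rw [mink_comm, mink_smul_left, mink_comm y]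

theorem HypSpace.sq_time (x : HypSpace d) : x.vec.1 ^ 2 = 1 + ‖x.vec.2‖ ^ 2 := by
  have h := x.mink_self
  simp only [mink, real_inner_self_eq_norm_sq] at h
  linarith [sq x.vec.1]

theorem HypSpace.one_le_neg_mink (x y : HypSpace d) : 1 ≤ -mink x.vec y.vec := by
  have hx := x.sq_time
  have hy := y.sq_time
  have h1 : (1 + ‖x.vec.2‖ * ‖y.vec.2‖) ^ 2 ≤ (x.vec.1 * y.vec.1) ^ 2 := by
    rw [mul_pow, hx, hy]
    nlinarith [sq_nonneg (‖x.vec.2‖ - ‖y.vec.2‖)]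
  have h2 := abs_le_of_sq_le_sq' h1 (mul_pos x.pos y.pos).le
  have h3 := real_inner_le_norm x.vec.2 y.vec.2
  simp only [mink]
  linarith [h2.2]

theorem HypSpace.eq_of_neg_mink_eq_one {x y : HypSpace d} (h : -mink x.vec y.vec = 1) :
    x = y := by
  have hx := x.sq_time
  have hy := y.sq_time
  have h3 := real_inner_le_norm x.vec.2 y.vec.2
  have hin : inner ℝ x.vec.2 y.vec.2 = x.vec.1 * y.vec.1 - 1 := by
    simp only [mink] at h
    linarith
  have hp : 0 < x.vec.1 * y.vec.1 := mul_pos x.pos y.pos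
  have h4 : (x.vec.1 * y.vec.1) ^ 2 ≤ (1 + ‖x.vec.2‖ * ‖y.vec.2‖) ^ 2 :=
    pow_le_pow_left₀ hp.le (by linarith) 2
  have h5 : ‖x.vec.2‖ = ‖y.vec.2‖ := by
    rw [mul_pow, hx, hy] at h4
    have : (‖x.vec.2‖ - ‖y.vec.2‖) ^ 2 ≤ 0 := by nlinarith
    have := pow_eq_zero_iff (two_ne_zero) |>.1 (le_antisymm this (sq_nonneg _))
    linarith
  have h6 : x.vec.1 = y.vec.1 := by
    have : x.vec.1 ^ 2 = y.vec.1 ^ 2 := by rw [hx, hy, h5]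
    exact (sq_eq_sq₀ x.pos.le y.pos.le).1 this
  have h7 : ‖x.vec.2 - y.vec.2‖ ^ 2 = 0 := by
    rw [norm_sub_sq_real, hin, ← h6, ← h5]
    nlinarith
  have h8 : x.vec.2 = y.vec.2 := by
    rw [← sub_eq_zero, ← norm_eq_zero]
    exact pow_eq_zero_iff (two_ne_zero) |>.1 h7
  exact HypSpace.ext (Prod.ext h6 h8)

/-- Vectors orthogonal to a point of hyperbolic space are spacelike. -/
theorem HypSpace.mink_self_nonneg (y : HypSpace d) {v : Mink d} (hv : mink v y.vec = 0) :
    0 ≤ mink v v := by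
  have hy := y.sq_time
  have h1 : inner ℝ v.2 y.vec.2 = v.1 * y.vec.1 := by
    simp only [mink] at hv
    linarith
  have h2 := abs_real_inner_le_norm v.2 y.vec.2
  have h3 : (v.1 * y.vec.1) ^ 2 ≤ (‖v.2‖ * ‖y.vec.2‖) ^ 2 := by
    rw [← h1]
    exact sq_le_sq' (by linarith [neg_abs_le (inner ℝ v.2 y.vec.2 : ℝ)])
      (by linarith [le_abs_self (inner ℝ v.2 y.vec.2 : ℝ)])
  rw [mul_pow, mul_pow, hy] at h3
  have h4 : v.1 ^ 2 ≤ ‖v.2‖ ^ 2 := by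
    by_contra hc
    push Not at hc
    nlinarith [sq_nonneg ‖y.vec.2‖, sq_nonneg ‖v.2‖]
  simp only [mink, real_inner_self_eq_norm_sq]
  nlinarith

theorem HypSpace.triangle_aux (x y z : HypSpace d) :
    -mink x.vec z.vec ≤ (-mink x.vec y.vec) * (-mink y.vec z.vec) +
      √((-mink x.vec y.vec) ^ 2 - 1) * √((-mink y.vec z.vec) ^ 2 - 1) := by
  set A := -mink x.vec y.vec with hA
  set B := -mink y.vec z.vec with hB
  set C := -mink x.vec z.vec with hC
  have hA1 : 1 ≤ A := x.one_le_neg_mink y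
  have hB1 : 1 ≤ B := y.one_le_neg_mink z
  have hx := x.mink_self
  have hy := y.mink_self
  have hz := z.mink_self
  have key : ∀ r : ℝ, 0 ≤ (B ^ 2 - 1) * (r * r) + (2 * (A * B - C)) * r + (A ^ 2 - 1) := by
    intro r
    have h := y.mink_self_nonneg
      (v := (x.vec - A • y.vec) + r • (z.vec - B • y.vec)) ?_
    · refine h.trans_eq ?_
      simp only [mink_sub_left, mink_add_left, mink_smul_left, mink_sub_right, mink_add_right,
        mink_smul_right, mink_comm y.vec x.vec, mink_comm z.vec x.vec, mink_comm z.vec y.vec,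
        hx, hy, hz, hA, hB, hC]
      ring
    · simp only [mink_sub_left, mink_add_left, mink_smul_left, mink_comm z.vec y.vec, hy, hA, hB]
      ring
  have hd := discrim_le_zero key
  simp only [discrim] at hd
  have h1 : (C - A * B) ^ 2 ≤ (A ^ 2 - 1) * (B ^ 2 - 1) := by nlinarith
  have h2 : C - A * B ≤ √((A ^ 2 - 1) * (B ^ 2 - 1)) := Real.le_sqrt_of_sq_le h1
  rw [Real.sqrt_mul (by nlinarith)] at h2
  linarith

/-- The hyperbolic distance: `cosh (dist x y) = -⟨x, y⟩`. -/
instance : Dist (HypSpace d) := ⟨fun x y => Real.arcosh (-mink x.vec y.vec)⟩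

theorem HypSpace.dist_def (x y : HypSpace d) :
    dist x y = Real.arcosh (-mink x.vec y.vec) := rfl

instance : MetricSpace (HypSpace d) where
  dist_self x := by simp [HypSpace.dist_def, x.mink_self]
  dist_comm x y := by rw [HypSpace.dist_def, HypSpace.dist_def, mink_comm]
  dist_triangle x y z := by
    have h1 := x.one_le_neg_mink y
    have h2 := y.one_le_neg_mink z
    have h3 := x.one_le_neg_mink z
    have hs : 0 ≤ dist x y + dist y z :=
      add_nonneg (Real.arcosh_nonneg h1) (Real.arcosh_nonneg h2)
    rw [← Real.arcosh_cosh hs, HypSpace.dist_def x z,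
      Real.arcosh_le_arcosh (by linarith) (Real.cosh_pos _), Real.cosh_add,
      HypSpace.dist_def, HypSpace.dist_def, Real.cosh_arcosh h1, Real.cosh_arcosh h2,
      Real.sinh_arcosh h1, Real.sinh_arcosh h2]
    exact x.triangle_aux y z
  eq_of_dist_eq_zero {x y} h :=
    HypSpace.eq_of_neg_mink_eq_one ((Real.arcosh_eq_zero_iff (x.one_le_neg_mink y)).1 h)

instance : MeasurableSpace (HypSpace d) := borel _

instance : BorelSpace (HypSpace d) := ⟨rfl⟩

/-! ### Intrinsic metric of a subset -/

/-- The intrinsic (length) distance of a metric space: the infimum of the lengths of all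
continuous curves from `x` to `y` (`∞` if there is no rectifiable one). Applied to a smooth
submanifold, with the distance restricted from the ambient space, this is its Riemannian
distance. -/
def lengthEDist {X : Type*} [PseudoEMetricSpace X] (x y : X) : ℝ≥0∞ :=
  ⨅ γ : Path x y, eVariationOn γ univ

/-- Every sequence that is Cauchy for the intrinsic distance converges for it. -/
def IntrinsicallyComplete (X : Type*) [PseudoEMetricSpace X] : Prop :=
  ∀ u : ℕ → X,
    (∀ ε : ℝ≥0∞, 0 < ε → ∃ N, ∀ m ≥ N, ∀ n ≥ N, lengthEDist (u m) (u n) < ε) →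
    ∃ x : X, Tendsto (fun n => lengthEDist (u n) x) atTop (𝓝 0)

/-- `S` is a closed ball (of some finite radius `r ≥ 0`) for the intrinsic distance of `H`. -/
def IsIntrinsicBall {X : Type*} [PseudoEMetricSpace X] (H S : Set X) : Prop :=
  ∃ (c : H) (r : ℝ), 0 ≤ r ∧
    S = (↑) '' {x : H | lengthEDist c x ≤ ENNReal.ofReal r}

/-! ### Hypersurfaces, second fundamental form, `λ`-geodesic hyperplanes -/

/-- A map into a subset of hyperbolic space, read as a map into Minkowski space. -/
def paramVec {H : Set (HypSpace d)} {E : Type*} (e : E → H) : E → Mink d :=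
  fun u => (e u : HypSpace d).vec

/-- A smooth local parametrization of `H` by `d - 1` parameters: a homeomorphism from an open
set of parameters onto a relatively open subset of `H`, smooth, with injective differential. -/
def IsSmoothParam {H : Set (HypSpace d)}
    (e : OpenPartialHomeomorph (EuclideanSpace ℝ (Fin (d - 1))) H) : Prop :=
  ContDiffOn ℝ ∞ (paramVec e) e.source ∧
    ∀ u ∈ e.source, Function.Injective (fderiv ℝ (paramVec e) u)

/-- `H` is a smooth (embedded) hypersurface of hyperbolic space. -/
def IsHypersurface (H : Set (HypSpace d)) : Prop :=
  ∀ p : H, ∃ e : OpenPartialHomeomorph (EuclideanSpace ℝ (Fin (d - 1))) H,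
    IsSmoothParam e ∧ p ∈ e.target

/-- `n` is a smooth unit normal field along `H`: `n p` is a unit vector, tangent to hyperbolic
space at `p` and orthogonal to the tangent space of `H` at `p`. -/
def IsUnitNormalField {H : Set (HypSpace d)} (n : H → Mink d) : Prop :=
  (∀ p : H, mink (n p) (n p) = 1 ∧ mink (n p) (p : HypSpace d).vec = 0) ∧
    ∀ e : OpenPartialHomeomorph (EuclideanSpace ℝ (Fin (d - 1))) H, IsSmoothParam e →
      ContDiffOn ℝ ∞ (n ∘ e) e.source ∧
      ∀ u ∈ e.source, ∀ v, mink (fderiv ℝ (paramVec e) u v) (n (e u)) = 0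

/-- The orthogonal projection of Minkowski space onto the tangent space of hyperbolic space at
`p`. -/
def tangentProj (p : HypSpace d) (z : Mink d) : Mink d := z + mink z p.vec • p.vec

/-- The covariant derivative `∇_X Y` at the point `e u`, for the coordinate fields `X = ∂_v e` and
`Y = ∂_w e` of a parametrization `e`; the Levi-Civita connection of hyperbolic space is the
tangential part of the derivative in Minkowski space. -/
def covDeriv {H : Set (HypSpace d)}
    (e : OpenPartialHomeomorph (EuclideanSpace ℝ (Fin (d - 1))) H)
    (u v w : EuclideanSpace ℝ (Fin (d - 1))) : Mink d :=
  tangentProj (e u : HypSpace d)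
    (fderiv ℝ (fun u' => fderiv ℝ (paramVec e) u' w) u v)

/-- `H` is totally umbilic with normal curvature `lam` with respect to the unit normal field `n`:
the second fundamental form `B(X, Y) = g(∇_X Y, n)` equals `lam * g(X, Y)` at every point. -/
def IsTotallyUmbilicWith {H : Set (HypSpace d)} (n : H → Mink d) (lam : ℝ) : Prop :=
  ∀ e : OpenPartialHomeomorph (EuclideanSpace ℝ (Fin (d - 1))) H, IsSmoothParam e →
    ∀ u ∈ e.source, ∀ v w,
      mink (covDeriv e u v w) (n (e u)) =
        lam * mink (fderiv ℝ (paramVec e) u v) (fderiv ℝ (paramVec e) u w)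

/-- A `lam`-geodesic hyperplane: a (connected) complete totally umbilic hypersurface of normal
curvature `lam`, for a suitable choice of the unit normal. -/
def IsLambdaGeodesicHyperplane (lam : ℝ) (H : Set (HypSpace d)) : Prop :=
  IsConnected H ∧ IsHypersurface H ∧ IntrinsicallyComplete H ∧
    ∃ n : H → Mink d, IsUnitNormalField n ∧ IsTotallyUmbilicWith n lam

/-! ### Signed distance -/

/-- Geodesic convexity: with two points, `C` contains the geodesic segment between them. -/
def GeodesicallyConvex (C : Set (HypSpace d)) : Prop :=
  ∀ x ∈ C, ∀ y ∈ C, ∀ z, dist x z + dist z y = dist x y → z ∈ C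

/-- `C` is a convex side of `H`: a convex domain among those bounded by `H`, that is, among the
connected components of the complement. (For a `lam`-geodesic hyperplane with `0 < lam` there is
exactly one, for `lam = 0` both sides are convex, and choosing one is choosing an orientation.) -/
def IsConvexSide (H C : Set (HypSpace d)) : Prop :=
  (∃ x ∈ Hᶜ, C = connectedComponentIn Hᶜ x) ∧ GeodesicallyConvex C

open Classical in
/-- The signed distance from `o` to `H`: positive if `o` lies in the chosen convex side `C`. -/
def signedDist (H C : Set (HypSpace d)) (o : HypSpace d) : ℝ :=
  if o ∈ C then Metric.infDist o H else -Metric.infDist o H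

/-! ### Constants -/

/-- The volume of the `k`-dimensional Euclidean unit ball. -/
def ballVolume (k : ℕ) : ℝ :=
  (volume : Measure (EuclideanSpace ℝ (Fin k))).real (Metric.ball 0 1)

/-- The surface area of the `k`-dimensional Euclidean unit ball (`2` for `k = 1`). -/
def ballSurface (k : ℕ) : ℝ :=
  (volume : Measure (EuclideanSpace ℝ (Fin k))).toSphere.real univ

/-- `ρ(s; R) = arcosh ((cosh R - sinh Δ sinh (s - Δ)) / (cosh Δ cosh (s - Δ)))` with
`Δ = artanh lam`. -/
def rho (lam s R : ℝ) : ℝ :=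
  Real.arcosh ((Real.cosh R - Real.sinh (Real.artanh lam) * Real.sinh (s - Real.artanh lam)) /
    (Real.cosh (Real.artanh lam) * Real.cosh (s - Real.artanh lam)))

end Hyperbolic

end

open Hyperbolic

/-! Along a totally umbilic hypersurface of curvature λ in the hyperboloid model, the position
vector x and the unit normal n satisfy d(n + λx) = 0. By connectedness w = n + λx is constant
(`normal_add_smul_const`), so ⟨w,w⟩ = 1 - λ² and H lies in the affine section ⟨x,w⟩ = -λ. The
inverse function theorem makes H open in that section, and completeness keeps radial curves from
leaving H. Hence H is the whole section (`TangentFrame.eq_umbilicLevel`).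

The section is a space of constant curvature -(1 - λ²). Around any of its points p it has a
stereographic chart a ↦ x_a with conformal factor c(a) = 4 / (4 - (1 - λ²)|a|²), in which ⟨x_a, x_b⟩
= -1 - c(a)c(b)|a - b|²/2 (`TangentFrame.mink_stereoVec`). All the metric information comes from
this identity: the intrinsic distance from p is an explicit increasing function of |a|
(`TangentFrame.lengthEDist_stereo`), and the chart scales distances infinitesimally by c, so areas
are integrals of c^(d-1) (`euclideanHausdorffMeasure_image_conformal`).

Now let p be the foot of the perpendicular from o, so that o = cosh s · p + sinh s · n
(`exists_foot`). Then cosh dist(x_a, o) = cosh s + (cosh s - λ sinh s) h(a) with h(a) = c(a)|a|²/2.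
The coefficient is positive and h increases with |a|, so the ball cuts out an intrinsic ball centred
at p, which is non-empty exactly when cosh s ≤ cosh R. Solving for its radius and integrating in
polar coordinates gives both formulas (`umbilicLevel_inter_closedBall`).

It remains to identify s, defined by ⟨o,w⟩ = sinh s - λ cosh s, with the signed distance. Its
absolute value is the distance. For λ > 0 the complement consists of two connected sides, and the
side ⟨x,w⟩ < -λ is not convex, so the convex side is the one where s > 0 (`convexSide_eq`). For λ =
0 replacing w by -w exchanges the sides. -/

noncomputable section

namespace Hyperbolic

/-! ### Rotationally symmetric coordinates of constant curvature `-m ^ 2` -/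

/-- The conformal factor, at distance `r` from the origin, of the ball model of the space of
curvature `-K`. -/
def conformalFactor (K r : ℝ) : ℝ := 4 / (4 - K * r ^ 2)

/-- The Euclidean radius, in the ball model of curvature `-m ^ 2`, of the sphere of radius `t`. -/
def modelRadius (m t : ℝ) : ℝ := if m = 0 then t else 2 / m * Real.tanh (m * t / 2)

/-- The inverse of `modelRadius m`. -/
def intrinsicRadius (m r : ℝ) : ℝ := if m = 0 then r else 2 / m * Real.artanh (m * r / 2)

/-- The generalised sine `2 / m * sinh (m * t / 2)`. -/
def chordLength (m t : ℝ) : ℝ := if m = 0 then t else 2 / m * Real.sinh (m * t / 2)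

theorem conformalFactor_pos {K r : ℝ} (h : K * r ^ 2 < 4) : 0 < conformalFactor K r :=
  div_pos (by norm_num) (by linarith)

@[simp] theorem modelRadius_zero (m : ℝ) : modelRadius m 0 = 0 := by simp [modelRadius]

theorem continuous_modelRadius (m : ℝ) : Continuous (modelRadius m) := by
  unfold modelRadius
  split_ifs
  · exact continuous_id
  · have : Continuous Real.tanh := by
      simp only [funext Real.tanh_eq_sinh_div_cosh]
      exact Real.continuous_sinh.div Real.continuous_cosh fun x => (Real.cosh_pos x).ne'
    fun_prop

theorem four_sub_sq_modelRadius {m : ℝ} (hm : m ≠ 0) (t : ℝ) :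
    4 - m ^ 2 * modelRadius m t ^ 2 = 4 / Real.cosh (m * t / 2) ^ 2 := by
  have hc := (Real.cosh_pos (m * t / 2)).ne'
  rw [modelRadius, if_neg hm, Real.tanh_eq_sinh_div_cosh]
  field_simp
  linarith [Real.cosh_sq (m * t / 2)]

theorem sq_mul_sq_modelRadius_lt (m t : ℝ) : m ^ 2 * modelRadius m t ^ 2 < 4 := by
  rcases eq_or_ne m 0 with rfl | hm
  · norm_num
  · have h := four_sub_sq_modelRadius hm t
    have : 0 < 4 / Real.cosh (m * t / 2) ^ 2 := by
      have := Real.cosh_pos (m * t / 2)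
      positivity
    linarith

theorem conformalFactor_modelRadius {m : ℝ} (hm : m ≠ 0) (t : ℝ) :
    conformalFactor (m ^ 2) (modelRadius m t) = Real.cosh (m * t / 2) ^ 2 := by
  have hc := (Real.cosh_pos (m * t / 2)).ne'
  rw [conformalFactor, four_sub_sq_modelRadius hm]
  field_simp

/-- This is tanh x - tanh y = sinh (x - y) / (cosh x cosh y), the conformal factors cancelling the
denominators. Along a ray the chord therefore depends on t - t' only, so t is an arc length
parameter. -/
theorem conformalFactor_mul_sq_sub (m t t' : ℝ) :
    conformalFactor (m ^ 2) (modelRadius m t) * conformalFactor (m ^ 2) (modelRadius m t') *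
      (modelRadius m t - modelRadius m t') ^ 2 = chordLength m (t - t') ^ 2 := by
  rcases eq_or_ne m 0 with rfl | hm
  · simp [conformalFactor, modelRadius, chordLength]
  · have hc := (Real.cosh_pos (m * t / 2)).ne'
    have hc' := (Real.cosh_pos (m * t' / 2)).ne'
    rw [conformalFactor_modelRadius hm, conformalFactor_modelRadius hm, modelRadius, modelRadius,
      chordLength, if_neg hm, if_neg hm, if_neg hm, Real.tanh_eq_sinh_div_cosh,
      Real.tanh_eq_sinh_div_cosh,
      show m * (t - t') / 2 = m * t / 2 - m * t' / 2 by ring, Real.sinh_sub]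
    field_simp

theorem modelRadius_nonneg {m t : ℝ} (hm : 0 ≤ m) (ht : 0 ≤ t) : 0 ≤ modelRadius m t := by
  unfold modelRadius
  split_ifs
  · exact ht
  · rw [Real.tanh_eq_sinh_div_cosh]
    have := Real.cosh_pos (m * t / 2)
    have : 0 ≤ Real.sinh (m * t / 2) := Real.sinh_nonneg_iff.2 (by positivity)
    positivity

theorem intrinsicRadius_nonneg {m r : ℝ} (hm : 0 ≤ m) (hr : 0 ≤ r) : 0 ≤ intrinsicRadius m r := by
  unfold intrinsicRadius
  split_ifs
  · exact hr
  · exact mul_nonneg (by positivity) (Real.artanh_nonneg (by positivity))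

theorem modelRadius_intrinsicRadius {m r : ℝ} (hm : 0 ≤ m) (hr : 0 ≤ r) (h : m ^ 2 * r ^ 2 < 4) :
    modelRadius m (intrinsicRadius m r) = r := by
  rcases hm.eq_or_lt with rfl | hm
  · simp [modelRadius, intrinsicRadius]
  · rw [modelRadius, intrinsicRadius, if_neg hm.ne', if_neg hm.ne']
    rw [show m * (2 / m * Real.artanh (m * r / 2)) / 2 = Real.artanh (m * r / 2) by field_simp,
      Real.tanh_artanh]
    · field_simp
    · have : 0 ≤ m * r := by positivity
      constructor <;> nlinarith

theorem modelRadius_le_modelRadius {m t t' : ℝ} (hm : 0 ≤ m) :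
    modelRadius m t ≤ modelRadius m t' ↔ t ≤ t' := by
  rcases hm.eq_or_lt with rfl | hm
  · simp [modelRadius]
  · rw [modelRadius, modelRadius, if_neg hm.ne', if_neg hm.ne',
      mul_le_mul_iff_right₀ (by positivity), ← Real.artanh_le_artanh_iff
      ⟨Real.neg_one_lt_tanh _, Real.tanh_lt_one _⟩ ⟨Real.neg_one_lt_tanh _, Real.tanh_lt_one _⟩,
      Real.artanh_tanh, Real.artanh_tanh, div_le_div_iff_of_pos_right (by norm_num),
      mul_le_mul_iff_right₀ hm]

theorem abs_le_abs_chordLength {m : ℝ} (hm : 0 ≤ m) (t : ℝ) : |t| ≤ |chordLength m t| := by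
  unfold chordLength
  split_ifs with h
  · exact le_rfl
  · have hm' : 0 < m := lt_of_le_of_ne hm (Ne.symm h)
    rw [abs_mul, Real.abs_sinh, abs_of_pos (by positivity : 0 < 2 / m), abs_div, abs_mul,
      abs_of_pos hm', abs_two]
    have := Real.self_le_sinh_iff.2 (show 0 ≤ m * |t| / 2 by positivity)
    calc |t| = 2 / m * (m * |t| / 2) := by field_simp
      _ ≤ _ := by gcongr

/-- The difference of the two sides vanishes at 0 and has derivative m (cosh x - cosh (m x)) ≥ 0. -/
theorem sinh_mul_le {m x : ℝ} (hm : 0 ≤ m) (hm1 : m ≤ 1) (hx : 0 ≤ x) :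
    Real.sinh (m * x) ≤ m * Real.sinh x := by
  have hmono : MonotoneOn (fun y => m * Real.sinh y - Real.sinh (m * y)) (Ici 0) := by
    refine monotoneOn_of_hasDerivWithinAt_nonneg (f' := fun y => m * Real.cosh y -
      Real.cosh (m * y) * m) (convex_Ici 0) (by fun_prop) (fun y _ => ?_) (fun y hy => ?_)
    · refine HasDerivAt.hasDerivWithinAt ?_
      have h1 := (Real.hasDerivAt_sinh y).const_mul m
      have h2 : HasDerivAt (fun y => Real.sinh (m * y)) (Real.cosh (m * y) * m) y :=
        (by simpa using ((hasDerivAt_id y).const_mul m).sinh)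
      exact h1.sub h2
    · rw [interior_Ici] at hy
      have hy : 0 < y := hy
      have : Real.cosh (m * y) ≤ Real.cosh y := by
        rw [Real.cosh_le_cosh, abs_of_nonneg (by positivity), abs_of_pos hy]
        nlinarith
      nlinarith
  have := hmono (mem_Ici.2 le_rfl) (mem_Ici.2 hx) hx
  simp only [mul_zero, Real.sinh_zero, sub_zero] at this
  linarith

/-- Compares curvature -m² with curvature -1. Because m ≤ 1, the radial curves of the chart will
have speed at most one in hyperbolic space. -/
theorem abs_chordLength_le {m : ℝ} (hm : 0 ≤ m) (hm1 : m ≤ 1) (t : ℝ) :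
    |chordLength m t| ≤ 2 * Real.sinh (|t| / 2) := by
  unfold chordLength
  split_ifs with h
  · have := Real.self_le_sinh_iff.2 (show 0 ≤ |t| / 2 by positivity)
    linarith
  · have hm' : 0 < m := lt_of_le_of_ne hm (Ne.symm h)
    rw [abs_mul, Real.abs_sinh, abs_of_pos (by positivity : 0 < 2 / m), abs_div, abs_mul,
      abs_of_pos hm', abs_two]
    have := sinh_mul_le hm hm1 (show 0 ≤ |t| / 2 by positivity)
    calc 2 / m * Real.sinh (m * |t| / 2) ≤ 2 / m * (m * Real.sinh (|t| / 2)) := by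
          rw [mul_div_assoc]; gcongr
      _ = _ := by field_simp

/-! ### Intrinsic distance -/

theorem edist_le_lengthEDist {X : Type*} [PseudoEMetricSpace X] (x y : X) :
    edist x y ≤ lengthEDist x y := by
  refine le_iInf fun γ => ?_
  have := eVariationOn.edist_le γ (mem_univ 0) (mem_univ 1)
  simpa using this

/-- A curve of speed at most one that stays in `H` bounds the intrinsic distance of `H`. -/
theorem lengthEDist_le_of_lipschitz {X : Type*} [PseudoMetricSpace X] {H : Set X} {γ : ℝ → X}
    {a b : ℝ} (hab : a ≤ b) (hγ : ∀ s ∈ Icc a b, ∀ t ∈ Icc a b, dist (γ s) (γ t) ≤ |s - t|)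
    (hH : ∀ t ∈ Icc a b, γ t ∈ H) :
    lengthEDist (⟨γ a, hH a (left_mem_Icc.2 hab)⟩ : H) ⟨γ b, hH b (right_mem_Icc.2 hab)⟩ ≤
      ENNReal.ofReal (b - a) := by
  set p : unitInterval → ℝ := fun t => a + t * (b - a) with hp
  have hpm : ∀ t : unitInterval, p t ∈ Icc a b := fun t => by
    have h0 := t.2.1
    have h1 := t.2.2
    constructor <;> simp only [hp] <;> nlinarith
  have hpmono : Monotone p := fun s t hst => by
    have : (s : ℝ) ≤ t := hst
    simp only [hp]
    nlinarith
  let q : unitInterval → H := fun t => ⟨γ (p t), hH _ (hpm t)⟩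
  have hq : ∀ s t, dist (q s) (q t) ≤ |p s - p t| := fun s t => hγ _ (hpm s) _ (hpm t)
  have hcont : Continuous q := by
    have : LipschitzWith (b - a).toNNReal q := by
      refine LipschitzWith.of_dist_le_mul fun s t => (hq s t).trans_eq ?_
      rw [Real.coe_toNNReal _ (by linarith), Subtype.dist_eq, Real.dist_eq]
      simp only [hp]
      rw [show a + s * (b - a) - (a + t * (b - a)) = (b - a) * ((s : ℝ) - t) by ring, abs_mul,
        abs_of_nonneg (by linarith : 0 ≤ b - a)]
    exact this.continuous
  let P : Path (⟨γ a, hH a (left_mem_Icc.2 hab)⟩ : H) ⟨γ b, hH b (right_mem_Icc.2 hab)⟩ :=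
    { toFun := q
      continuous_toFun := hcont
      source' := by simp [q, hp]
      target' := by simp [q, hp] }
  refine (iInf_le _ P).trans (iSup_le fun ⟨n, u, hu, _⟩ => ?_)
  calc ∑ i ∈ Finset.range n, edist (P (u (i + 1))) (P (u i))
      ≤ ∑ i ∈ Finset.range n, ENNReal.ofReal (p (u (i + 1)) - p (u i)) := by
        refine Finset.sum_le_sum fun i _ => ?_
        rw [edist_dist]
        refine ENNReal.ofReal_le_ofReal ((hq _ _).trans_eq (abs_of_nonneg ?_))
        exact sub_nonneg.2 (hpmono (hu i.le_succ))
    _ = ENNReal.ofReal (∑ i ∈ Finset.range n, (p (u (i + 1)) - p (u i))) :=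
        (ENNReal.ofReal_sum_of_nonneg fun i _ => sub_nonneg.2 (hpmono (hu i.le_succ))).symm
    _ ≤ ENNReal.ofReal (b - a) := by
        rw [Finset.sum_range_sub (fun i => p (u i))]
        exact ENNReal.ofReal_le_ofReal (by linarith [(hpm (u n)).2, (hpm (u 0)).1])

theorem sinh_le_mul_cosh {x : ℝ} (hx : 0 ≤ x) : Real.sinh x ≤ x * Real.cosh x := by
  have hmono : MonotoneOn (fun y => y * Real.cosh y - Real.sinh y) (Ici 0) := by
    refine monotoneOn_of_hasDerivWithinAt_nonneg (f' := fun y => y * Real.sinh y)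
      (convex_Ici 0) (by fun_prop) (fun y _ => ?_) (fun y hy => ?_)
    · refine HasDerivAt.hasDerivWithinAt ?_
      refine (((hasDerivAt_id y).mul (Real.hasDerivAt_cosh y)).sub
        (Real.hasDerivAt_sinh y)).congr_deriv ?_
      simp
    · rw [interior_Ici] at hy
      exact mul_nonneg (le_of_lt hy) (Real.sinh_nonneg_iff.2 (le_of_lt hy))
  have := hmono (mem_Ici.2 le_rfl) (mem_Ici.2 hx) hx
  simp only [zero_mul, Real.sinh_zero, sub_zero] at this
  linarith

/-- Distances enter the chart identity as 2 sinh (dist / 2). This bound and x ≤ sinh x make that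
quantity interchangeable with the distance to first order. -/
theorem exists_two_mul_sinh_half_le {c : ℝ} (hc : 1 < c) :
    ∃ δ > 0, ∀ x, 0 ≤ x → x < δ → 2 * Real.sinh (x / 2) ≤ c * x := by
  have h : ∀ᶠ x in 𝓝 (0 : ℝ), Real.cosh (x / 2) < c := by
    have : ContinuousAt (fun x : ℝ => Real.cosh (x / 2)) 0 := by fun_prop
    exact this.eventually_lt_const (by simpa using hc)
  obtain ⟨δ, hδ, h⟩ := Metric.eventually_nhds_iff.1 h
  refine ⟨δ, hδ, fun x hx hxδ => ?_⟩
  have h1 := h (y := x) (by rwa [Real.dist_eq, sub_zero, abs_of_nonneg hx])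
  have h2 := sinh_le_mul_cosh (show 0 ≤ x / 2 by positivity)
  nlinarith

/-- A function that is infinitesimally `1`-Lipschitz is `1`-Lipschitz for the intrinsic
distance. -/
theorem ofReal_abs_sub_le_lengthEDist {X : Type*} [PseudoMetricSpace X] {G : X → ℝ}
    (hG : ∀ x y, |G x - G y| ≤ 2 * Real.sinh (dist x y / 2)) (x y : X) :
    ENNReal.ofReal |G x - G y| ≤ lengthEDist x y := by
  refine le_iInf fun γ => ?_
  -- A subdivision fine enough for 2 sinh (x / 2) ≤ c x costs a factor c, which is removed by
  -- letting c decrease to 1.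
  suffices h : ∀ c : ℝ, 1 < c →
      ENNReal.ofReal |G x - G y| ≤ ENNReal.ofReal c * eVariationOn γ univ by
    have hlim : Tendsto (fun c : ℝ => ENNReal.ofReal c * eVariationOn γ univ) (𝓝[>] 1)
        (𝓝 (ENNReal.ofReal 1 * eVariationOn γ univ)) := by
      refine ENNReal.Tendsto.mul_const ?_ (Or.inl (by simp))
      exact (ENNReal.continuous_ofReal.tendsto 1).mono_left nhdsWithin_le_nhds
    rw [ENNReal.ofReal_one, one_mul] at hlim
    exact ge_of_tendsto hlim (eventually_nhdsWithin_of_forall h)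
  intro c hc
  obtain ⟨δ, hδ, hsinh⟩ := exists_two_mul_sinh_half_le hc
  obtain ⟨η, hη, hγ⟩ := Metric.uniformContinuous_iff.1
    (CompactSpace.uniformContinuous_of_continuous γ.continuous) δ hδ
  obtain ⟨N, hN⟩ := exists_nat_one_div_lt hη
  -- Equidistant subdivision of mesh 1 / (N + 1) < η, so consecutive points of the curve are closer
  -- than δ. The projection fixes the indices beyond N + 1 at the end point, which makes the
  -- sequence monotone on all of ℕ.
  set u : ℕ → unitInterval := fun i => projIcc 0 1 zero_le_one ((i : ℝ) / (N + 1)) with hu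
  have humono : Monotone u := fun i j hij => by
    refine monotone_projIcc _ ?_
    have : (i : ℝ) ≤ j := by exact_mod_cast hij
    gcongr
  have hstep : ∀ i, dist (u (i + 1)) (u i) < η := fun i => by
    have h := (LipschitzWith.projIcc (zero_le_one (α := ℝ))).dist_le_mul
      (((i + 1 : ℕ) : ℝ) / (N + 1)) ((i : ℝ) / (N + 1))
    refine h.trans_lt ?_
    rw [Real.dist_eq, NNReal.coe_one, one_mul, ← sub_div]
    push_cast
    rw [add_sub_cancel_left, abs_of_nonneg (by positivity)]
    exact hN
  have hG' : ∀ i, |G (γ (u (i + 1))) - G (γ (u i))| ≤ c * dist (γ (u (i + 1))) (γ (u i)) :=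
    fun i => (hG _ _).trans (hsinh _ dist_nonneg (hγ (hstep i)))
  have hu0 : u 0 = 0 := by
    simp only [hu, Nat.cast_zero, zero_div]
    exact projIcc_left (zero_le_one (α := ℝ))
  have hu1 : u (N + 1) = 1 := by
    have : (((N + 1 : ℕ) : ℝ)) / (N + 1) = 1 := by
      push_cast
      exact div_self (by positivity)
    simp only [hu, this]
    exact projIcc_right (zero_le_one (α := ℝ))
  calc ENNReal.ofReal |G x - G y|
      = ENNReal.ofReal |∑ i ∈ Finset.range (N + 1), (G (γ (u (i + 1))) - G (γ (u i)))| := by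
        rw [Finset.sum_range_sub (fun i => G (γ (u i))), hu0, hu1, γ.source, γ.target,
          abs_sub_comm]
    _ ≤ ENNReal.ofReal (∑ i ∈ Finset.range (N + 1), c * dist (γ (u (i + 1))) (γ (u i))) :=
        ENNReal.ofReal_le_ofReal ((Finset.abs_sum_le_sum_abs _ _).trans
          (Finset.sum_le_sum fun i _ => hG' i))
    _ = ENNReal.ofReal c * ∑ i ∈ Finset.range (N + 1), edist (γ (u (i + 1))) (γ (u i)) := by
        rw [← Finset.mul_sum, ENNReal.ofReal_mul (by linarith),
          ENNReal.ofReal_sum_of_nonneg fun i _ => dist_nonneg]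
        simp only [edist_dist]
    _ ≤ ENNReal.ofReal c * eVariationOn γ univ := by
        gcongr
        exact eVariationOn.sum_le humono fun _ => mem_univ _

/-! ### Hausdorff measure of the image of a conformal map -/

section Conformal

variable {k : ℕ} {X : Type*} [MetricSpace X] [MeasurableSpace X] [BorelSpace X]

theorem euclideanHausdorffMeasure_image_le {Y : Type*} [MetricSpace Y] [MeasurableSpace Y]
    [BorelSpace Y] {f : Y → X} {S : Set Y} {K : ℝ} (hK : 0 ≤ K)
    (hf : ∀ a ∈ S, ∀ b ∈ S, dist (f a) (f b) ≤ K * dist a b) :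
    Measure.euclideanHausdorffMeasure k (f '' S) ≤
      ENNReal.ofReal K ^ k * Measure.euclideanHausdorffMeasure k S := by
  have h : LipschitzOnWith K.toNNReal f S := LipschitzOnWith.of_dist_le_mul fun a ha b hb => by
    rw [Real.coe_toNNReal _ hK]
    exact hf a ha b hb
  have := h.hausdorffMeasure_image_le (d := (k : ℝ)) (Nat.cast_nonneg k)
  rw [ENNReal.rpow_natCast] at this
  simp only [Measure.euclideanHausdorffMeasure_def, Measure.smul_apply, ENNReal.smul_def,
    smul_eq_mul]
  rw [mul_left_comm]
  gcongr
  exact this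

theorem ennreal_le_of_forall_one_lt {a b : ℝ≥0∞} (n : ℕ)
    (h : ∀ t : ℝ, 1 < t → a ≤ ENNReal.ofReal t ^ n * b) : a ≤ b := by
  have hlim : Tendsto (fun t : ℝ => ENNReal.ofReal t ^ n * b) (𝓝[>] 1)
      (𝓝 (ENNReal.ofReal 1 ^ n * b)) := by
    refine ENNReal.Tendsto.mul_const ?_ (Or.inl (by simp))
    exact (((ENNReal.continuous_pow n).comp ENNReal.continuous_ofReal).tendsto 1).mono_left
      nhdsWithin_le_nhds
  rw [ENNReal.ofReal_one, one_pow, one_mul] at hlim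
  exact ge_of_tendsto hlim (eventually_nhdsWithin_of_forall h)

variable {φ : EuclideanSpace ℝ (Fin k) → X} {c : EuclideanSpace ℝ (Fin k) → ℝ}

/-- On a small piece φ is a similarity of ratio q up to a factor t, and c equals q up to a factor t.
Applying the Lipschitz bound to φ and to its inverse compares both quantities with q^k vol S, and
the two errors t^k multiply to t^(2k). -/
theorem euclideanHausdorffMeasure_image_comparable {S : Set (EuclideanSpace ℝ (Fin k))}
    (hS : MeasurableSet S) {t q : ℝ} (ht : 1 < t) (hq : 0 < q)
    (hc : ∀ a ∈ S, q ≤ t * c a ∧ c a ≤ t * q)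
    (hφ : ∀ a ∈ S, ∀ b ∈ S, dist (φ a) (φ b) ≤ t * q * dist a b ∧
      q * dist a b ≤ t * dist (φ a) (φ b)) :
    Measure.euclideanHausdorffMeasure k (φ '' S) ≤
        ENNReal.ofReal t ^ (2 * k) * ∫⁻ x in S, ENNReal.ofReal (c x) ^ k ∧
      ∫⁻ x in S, ENNReal.ofReal (c x) ^ k ≤
        ENNReal.ofReal t ^ (2 * k) * Measure.euclideanHausdorffMeasure k (φ '' S) := by
  have ht0 : 0 < t := by linarith
  have hvol := EuclideanSpace.euclideanHausdorffMeasure_eq_volume k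
  have h1 := euclideanHausdorffMeasure_image_le (k := k) (f := φ) (S := S)
    (K := t * q) (by positivity) fun a ha b hb => (hφ a ha b hb).1
  have hinj : InjOn φ S := fun a ha b hb hab => by
    have := (hφ a ha b hb).2
    rw [hab, dist_self, mul_zero] at this
    exact dist_le_zero.1 (by nlinarith [dist_nonneg (x := a) (y := b)])
  have h2 : Measure.euclideanHausdorffMeasure k S ≤
      ENNReal.ofReal (t / q) ^ k * Measure.euclideanHausdorffMeasure k (φ '' S) := by
    have := euclideanHausdorffMeasure_image_le (k := k) (f := Function.invFunOn φ S)
      (S := φ '' S) (K := t / q) (by positivity) ?_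
    · rwa [hinj.leftInvOn_invFunOn.image_image] at this
    · rintro _ ⟨a, ha, rfl⟩ _ ⟨b, hb, rfl⟩
      rw [hinj.leftInvOn_invFunOn ha, hinj.leftInvOn_invFunOn hb, div_mul_eq_mul_div,
        le_div_iff₀ hq, mul_comm]
      exact (hφ a ha b hb).2
  rw [hvol] at h1 h2
  have h3 : ENNReal.ofReal q ^ k * volume S ≤
      ENNReal.ofReal t ^ k * ∫⁻ x in S, ENNReal.ofReal (c x) ^ k := by
    rw [← lintegral_const_mul' _ _ (by simp), ← setLIntegral_const]
    refine setLIntegral_mono' hS fun a ha => ?_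
    rw [← mul_pow, ← ENNReal.ofReal_mul ht0.le]
    gcongr
    exact (hc a ha).1
  have h4 : ∫⁻ x in S, ENNReal.ofReal (c x) ^ k ≤ ENNReal.ofReal (t * q) ^ k * volume S := by
    rw [← setLIntegral_const]
    refine setLIntegral_mono' hS fun a ha => ?_
    gcongr
    exact (hc a ha).2
  constructor
  · refine h1.trans ?_
    rw [ENNReal.ofReal_mul ht0.le, mul_pow, mul_assoc, two_mul, pow_add, mul_assoc]
    gcongr
  · refine h4.trans ?_
    calc ENNReal.ofReal (t * q) ^ k * volume S
        ≤ ENNReal.ofReal (t * q) ^ k * (ENNReal.ofReal (t / q) ^ k *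
          Measure.euclideanHausdorffMeasure k (φ '' S)) := by gcongr
      _ = _ := by
        rw [← mul_assoc, ← mul_pow, ← ENNReal.ofReal_mul (by positivity),
          show t * q * (t / q) = t ^ 2 by field_simp, pow_mul, ENNReal.ofReal_pow ht0.le]

/-- The area formula for a map that scales distances infinitesimally by the factor `c`. -/
theorem euclideanHausdorffMeasure_image_conformal {D : Set (EuclideanSpace ℝ (Fin k))}
    (hc : ContinuousOn c D) (hpos : ∀ x ∈ D, 0 < c x) (hD : IsOpen D)
    (hinj : InjOn φ D)
    (hφ : ∀ x ∈ D, ∀ t : ℝ, 1 < t → ∃ U ∈ 𝓝 x, ∀ a ∈ U, ∀ b ∈ U,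
      dist (φ a) (φ b) ≤ t * c x * dist a b ∧ c x * dist a b ≤ t * dist (φ a) (φ b))
    {S : Set (EuclideanSpace ℝ (Fin k))} (hS : MeasurableSet S) (hSD : S ⊆ D) :
    Measure.euclideanHausdorffMeasure k (φ '' S) = ∫⁻ x in S, ENNReal.ofReal (c x) ^ k := by
  rcases S.eq_empty_or_nonempty with rfl | hne
  · simp
  have hφc : ContinuousOn φ D := fun x hx => by
    obtain ⟨U, hU, h⟩ := hφ x hx 2 one_lt_two
    refine ContinuousAt.continuousWithinAt ?_
    have : Tendsto (fun a => 2 * c x * dist a x) (𝓝 x) (𝓝 0) := by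
      have : Continuous fun a => 2 * c x * dist a x := by fun_prop
      simpa using this.tendsto x
    rw [ContinuousAt, tendsto_iff_dist_tendsto_zero]
    refine squeeze_zero' (Eventually.of_forall fun _ => dist_nonneg) ?_ this
    filter_upwards [hU] with a ha using (h a ha x (mem_of_mem_nhds hU)).1
  have key : ∀ t : ℝ, 1 < t →
      Measure.euclideanHausdorffMeasure k (φ '' S) ≤
        ENNReal.ofReal t ^ (2 * k) * ∫⁻ x in S, ENNReal.ofReal (c x) ^ k ∧
      ∫⁻ x in S, ENNReal.ofReal (c x) ^ k ≤
        ENNReal.ofReal t ^ (2 * k) * Measure.euclideanHausdorffMeasure k (φ '' S) := by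
    intro t ht
    have ht0 : 0 < t := by linarith
    -- Near each point both comparisons hold with ratio q = c x. A countable subcover, made
    -- disjoint, then reduces the estimate to pieces on which the comparison lemma applies.
    have hloc : ∀ x ∈ D, ∃ U : Set (EuclideanSpace ℝ (Fin k)), IsOpen U ∧ x ∈ U ∧
        (∀ a ∈ U, c x ≤ t * c a ∧ c a ≤ t * c x) ∧
        ∀ a ∈ U, ∀ b ∈ U, dist (φ a) (φ b) ≤ t * c x * dist a b ∧
          c x * dist a b ≤ t * dist (φ a) (φ b) := by
      intro x hx
      obtain ⟨U, hU, h⟩ := hφ x hx t ht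
      have hca : ContinuousAt c x := hc.continuousAt (hD.mem_nhds hx)
      have e1 : ∀ᶠ a in 𝓝 x, c x / t < c a :=
        hca.eventually_const_lt (div_lt_self (hpos x hx) ht)
      have e2 : ∀ᶠ a in 𝓝 x, c a < t * c x :=
        hca.eventually_lt_const (by nlinarith [hpos x hx])
      obtain ⟨V, hV, hVo, hxV⟩ := mem_nhds_iff.1 (inter_mem hU (e1.and e2))
      refine ⟨V, hVo, hxV, fun a ha => ⟨?_, (hV ha).2.2.le⟩, fun a ha b hb =>
        h a (hV ha).1 b (hV hb).1⟩
      have := (hV ha).2.1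
      rw [div_lt_iff₀ ht0] at this
      linarith
    choose! U hUo hxU hUc hUφ using hloc
    obtain ⟨T, hTD, hTc, hT⟩ := TopologicalSpace.countable_cover_nhdsWithin
      (fun x hx => mem_nhdsWithin_of_mem_nhds ((hUo x hx).mem_nhds (hxU x hx)) :
        ∀ x ∈ D, U x ∈ 𝓝[D] x)
    have hTne : T.Nonempty := by
      obtain ⟨x, hx⟩ := hne
      obtain ⟨i, hi, -⟩ := mem_iUnion₂.1 (hT (hSD hx))
      exact ⟨i, hi⟩
    obtain ⟨f, rfl⟩ := hTc.exists_eq_range hTne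
    have hfD : ∀ n, f n ∈ D := fun n => hTD (mem_range_self n)
    set W : ℕ → Set (EuclideanSpace ℝ (Fin k)) := fun n => S ∩ disjointed (U ∘ f) n with hW
    have hWm : ∀ n, MeasurableSet (W n) := fun n =>
      hS.inter (MeasurableSet.disjointed (fun i => (hUo _ (hfD i)).measurableSet) n)
    have hWU : ∀ n, W n ⊆ U (f n) := fun n =>
      inter_subset_right.trans (disjointed_subset (U ∘ f) n)
    have hWd : Pairwise (Function.onFun Disjoint W) := fun i j hij =>
      (disjoint_disjointed (U ∘ f) hij).mono inter_subset_right inter_subset_right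
    have hSW : S = ⋃ n, W n := by
      rw [← inter_iUnion, iUnion_disjointed, eq_comm, inter_eq_left]
      refine (hSD.trans hT).trans ?_
      rw [biUnion_range]
      rfl
    have hpiece := fun n => euclideanHausdorffMeasure_image_comparable (φ := φ) (c := c) (hWm n) ht
      (hpos _ (hfD n)) (fun a ha => hUc _ (hfD n) a (hWU n ha))
      (fun a ha b hb => hUφ _ (hfD n) a (hWU n ha) b (hWU n hb))
    have hWD : ∀ n, W n ⊆ D := fun n => inter_subset_left.trans hSD
    have e1 : Measure.euclideanHausdorffMeasure k (φ '' S) =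
        ∑' n, Measure.euclideanHausdorffMeasure k (φ '' W n) := by
      conv_lhs => rw [hSW, image_iUnion]
      -- Measurability of the images is the Lusin–Souslin theorem for injective continuous maps.
      refine measure_iUnion (fun i j hij => ?_) fun n =>
        (hWm n).image_of_continuousOn_injOn (hφc.mono (hWD n)) (hinj.mono (hWD n))
      exact (hWd hij).image hinj (hWD i) (hWD j)
    have e2 : ∫⁻ x in S, ENNReal.ofReal (c x) ^ k =
        ∑' n, ∫⁻ x in W n, ENNReal.ofReal (c x) ^ k := by
      conv_lhs => rw [hSW]
      exact lintegral_iUnion hWm hWd _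
    rw [e1, e2, ← ENNReal.tsum_mul_left, ← ENNReal.tsum_mul_left]
    exact ⟨ENNReal.tsum_le_tsum fun n => (hpiece n).1, ENNReal.tsum_le_tsum fun n => (hpiece n).2⟩
  exact le_antisymm (ennreal_le_of_forall_one_lt _ fun t ht => (key t ht).1)
    (ennreal_le_of_forall_one_lt _ fun t ht => (key t ht).2)

end Conformal

/-! ### Volume of balls in the model of constant curvature -/

theorem hasDerivAt_tanh (x : ℝ) : HasDerivAt Real.tanh (1 / Real.cosh x ^ 2) x := by
  have hc := (Real.cosh_pos x).ne'
  rw [show Real.tanh = fun y => Real.sinh y / Real.cosh y from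
    funext Real.tanh_eq_sinh_div_cosh]
  refine ((Real.hasDerivAt_sinh x).div (Real.hasDerivAt_cosh x) hc).congr_deriv ?_
  rw [← Real.cosh_sq_sub_sinh_sq x]
  ring

/-- Substitute y = (2 / m) tanh (v / 2). The conformal factor becomes cosh² (v / 2), dy = dv / (m
cosh² (v / 2)), and the remaining power is (2 sinh (v / 2) cosh (v / 2))^n = sinh^n v. -/
theorem integral_pow_mul_conformalFactor {m : ℝ} (hm : 0 < m) (n : ℕ) (t : ℝ) :
    ∫ y in (0 : ℝ)..modelRadius m t, y ^ n * conformalFactor (m ^ 2) y ^ (n + 1) =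
      1 / m ^ (n + 1) * ∫ u in (0 : ℝ)..m * t, Real.sinh u ^ n := by
  set T : ℝ → ℝ := fun v => modelRadius m (v / m) with hT
  have hTv : ∀ v, T v = 2 / m * Real.tanh (v / 2) := fun v => by
    rw [hT]
    simp only [modelRadius, if_neg hm.ne']
    congr 3
    field_simp
  have hd : ∀ v, HasDerivAt T (2 / m * (1 / Real.cosh (v / 2) ^ 2 * (1 / 2))) v := fun v => by
    rw [funext hTv]
    have h2 : HasDerivAt (fun v : ℝ => v / 2) (1 / 2) v := (hasDerivAt_id v).div_const 2
    exact ((hasDerivAt_tanh (v / 2)).comp v h2).const_mul _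
  have h0 : T 0 = 0 := by simp [hT]
  have h1 : T (m * t) = modelRadius m t := by
    simp only [hT]
    congr 1
    field_simp
  have hlt : ∀ v, m ^ 2 * T v ^ 2 < 4 := fun v => sq_mul_sq_modelRadius_lt m (v / m)
  have hcv := intervalIntegral.integral_comp_mul_deriv''' (a := 0) (b := m * t) (f := T)
    (f' := fun v => 2 / m * (1 / Real.cosh (v / 2) ^ 2 * (1 / 2)))
    (g := fun y => y ^ n * conformalFactor (m ^ 2) y ^ (n + 1))
    (fun v _ => (hd v).continuousAt.continuousWithinAt)
    (fun v _ => (hd v).hasDerivWithinAt) ?_ ?_ ?_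
  · rw [h0, h1] at hcv
    rw [← hcv, ← intervalIntegral.integral_const_mul]
    refine intervalIntegral.integral_congr fun v _ => ?_
    have hc := (Real.cosh_pos (v / 2)).ne'
    simp only [Function.comp]
    have hcf : conformalFactor (m ^ 2) (T v) = Real.cosh (v / 2) ^ 2 := by
      simp only [hT]
      rw [conformalFactor_modelRadius hm.ne']
      congr 2
      field_simp
    have hs : Real.sinh v = 2 * Real.sinh (v / 2) * Real.cosh (v / 2) := by
      rw [← Real.sinh_two_mul]
      congr 1
      ring
    rw [hcf, hTv, hs, Real.tanh_eq_sinh_div_cosh]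
    simp only [mul_pow, div_pow, pow_succ]
    field_simp
    rw [one_pow, mul_one]
  · refine ContinuousOn.mono (s := {y | m ^ 2 * y ^ 2 < 4}) ?_ ?_
    · refine ContinuousOn.mul (by fun_prop) (ContinuousOn.pow ?_ _)
      exact ContinuousOn.div (by fun_prop) (by fun_prop) fun y hy => (sub_pos.2 hy).ne'
    · rintro _ ⟨v, -, rfl⟩
      exact hlt v
  · refine ContinuousOn.integrableOn_compact ?_ ?_
    · exact isCompact_uIcc.image_of_continuousOn fun v _ =>
        (hd v).continuousAt.continuousWithinAt
    · refine ContinuousOn.mono (s := {y | m ^ 2 * y ^ 2 < 4}) ?_ ?_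
      · refine ContinuousOn.mul (by fun_prop) (ContinuousOn.pow ?_ _)
        exact ContinuousOn.div (by fun_prop) (by fun_prop) fun y hy => (sub_pos.2 hy).ne'
      · rintro _ ⟨v, -, rfl⟩
        exact hlt v
  · refine ContinuousOn.integrableOn_compact isCompact_uIcc ?_
    simp only [Function.comp_def, hTv, conformalFactor]
    have htc : Continuous Real.tanh := continuous_iff_continuousAt.2 fun x =>
      (hasDerivAt_tanh x).continuousAt
    refine ContinuousOn.mul (ContinuousOn.mul (by fun_prop) (ContinuousOn.pow
      (ContinuousOn.div (by fun_prop) (by fun_prop) fun v _ => ?_) _)) ?_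
    · rw [← hTv]
      exact (sub_pos.2 (hlt v)).ne'
    · refine Continuous.continuousOn ?_
      refine continuous_const.mul (Continuous.mul (Continuous.div (by fun_prop) (by fun_prop)
        fun v => (pow_pos (Real.cosh_pos _) 2).ne') continuous_const)

/-- Polar coordinates in dimension n + 1, followed by the substitution above. The density is
integrable because the ball stays away from the singularity m r = 2. -/
theorem lintegral_conformalFactor {m : ℝ} (hm : 0 < m) (n : ℕ) {t : ℝ} (ht : 0 ≤ t) :
    ∫⁻ x in Metric.closedBall (0 : EuclideanSpace ℝ (Fin (n + 1))) (modelRadius m t),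
        ENNReal.ofReal (conformalFactor (m ^ 2) ‖x‖) ^ (n + 1) =
      ENNReal.ofReal (ballSurface (n + 1) / m ^ (n + 1) *
        ∫ u in (0 : ℝ)..m * t, Real.sinh u ^ n) := by
  set r := modelRadius m t with hr
  have hr0 : 0 ≤ r := modelRadius_nonneg hm.le ht
  have hlt : ∀ y ∈ Icc 0 r, m ^ 2 * y ^ 2 < 4 := fun y hy => by
    have h1 := sq_mul_sq_modelRadius_lt m t
    have h2 : y ^ 2 ≤ r ^ 2 := pow_le_pow_left₀ hy.1 hy.2 2
    have : m ^ 2 * y ^ 2 ≤ m ^ 2 * r ^ 2 := by gcongr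
    linarith
  have hball : ∀ x ∈ Metric.closedBall (0 : EuclideanSpace ℝ (Fin (n + 1))) r,
      ‖x‖ ∈ Icc 0 r := fun x hx => ⟨norm_nonneg x, by simpa using hx⟩
  have hint : IntegrableOn (fun x : EuclideanSpace ℝ (Fin (n + 1)) =>
      conformalFactor (m ^ 2) ‖x‖ ^ (n + 1)) (Metric.closedBall 0 r) := by
    refine ContinuousOn.integrableOn_compact (isCompact_closedBall _ _) (ContinuousOn.pow ?_ _)
    exact ContinuousOn.div (by fun_prop) (by fun_prop) fun x hx =>
      (sub_pos.2 (hlt _ (hball x hx))).ne'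
  have hnn : 0 ≤ᵐ[volume.restrict (Metric.closedBall 0 r)]
      fun x : EuclideanSpace ℝ (Fin (n + 1)) => conformalFactor (m ^ 2) ‖x‖ ^ (n + 1) :=
    (ae_restrict_iff' measurableSet_closedBall).2 (Eventually.of_forall fun x hx =>
      pow_nonneg (conformalFactor_pos (hlt _ (hball x hx))).le _)
  have e1 : ∫⁻ x in Metric.closedBall (0 : EuclideanSpace ℝ (Fin (n + 1))) r,
        ENNReal.ofReal (conformalFactor (m ^ 2) ‖x‖) ^ (n + 1) =
      ∫⁻ x in Metric.closedBall (0 : EuclideanSpace ℝ (Fin (n + 1))) r,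
        ENNReal.ofReal (conformalFactor (m ^ 2) ‖x‖ ^ (n + 1)) :=
    setLIntegral_congr_fun measurableSet_closedBall fun x hx =>
      (ENNReal.ofReal_pow (conformalFactor_pos (hlt _ (hball x hx))).le _).symm
  rw [e1, ← ofReal_integral_eq_lintegral_ofReal hint hnn]
  congr 1
  have e2 : ∀ x : EuclideanSpace ℝ (Fin (n + 1)),
      (Metric.closedBall (0 : EuclideanSpace ℝ (Fin (n + 1))) r).indicator
        (fun x => conformalFactor (m ^ 2) ‖x‖ ^ (n + 1)) x =
      (Iic r).indicator (fun y => conformalFactor (m ^ 2) y ^ (n + 1)) ‖x‖ := fun x => by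
    simp [indicator]
  rw [← integral_indicator measurableSet_closedBall, funext e2,
    integral_fun_norm_addHaar volume
      ((Iic r).indicator fun y => conformalFactor (m ^ 2) y ^ (n + 1))]
  have e3 : ∀ y : ℝ, y ^ (n + 1 - 1) • (Iic r).indicator
      (fun y => conformalFactor (m ^ 2) y ^ (n + 1)) y =
      (Iic r).indicator (fun y => y ^ n * conformalFactor (m ^ 2) y ^ (n + 1)) y := fun y => by
    simp [indicator]
  simp only [finrank_euclideanSpace, Fintype.card_fin, e3]
  rw [setIntegral_indicator measurableSet_Iic, Ioi_inter_Iic,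
    ← intervalIntegral.integral_of_le hr0, hr, integral_pow_mul_conformalFactor hm, ballSurface,
    Measure.toSphere_real_apply_univ]
  simp only [finrank_euclideanSpace, Fintype.card_fin, nsmul_eq_mul, smul_eq_mul]
  ring

theorem lintegral_conformalFactor_zero (k : ℕ) {r : ℝ} (hr : 0 ≤ r) :
    ∫⁻ x in Metric.closedBall (0 : EuclideanSpace ℝ (Fin k)) r,
        ENNReal.ofReal (conformalFactor 0 ‖x‖) ^ k =
      ENNReal.ofReal (ballVolume k * r ^ k) := by
  have : conformalFactor 0 = fun _ => 1 := by
    funext y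
    simp [conformalFactor]
  simp only [this, ENNReal.ofReal_one, one_pow, lintegral_const, one_mul,
    Measure.restrict_apply_univ]
  rw [Measure.addHaar_closedBall _ _ hr, finrank_euclideanSpace, Fintype.card_fin, ballVolume,
    mul_comm, ENNReal.ofReal_mul measureReal_nonneg, measureReal_def, ENNReal.ofReal_toReal]
  exact measure_ball_lt_top.ne

variable {d : ℕ}

/-! ### Minkowski space -/

@[simp] theorem mink_zero_right (x : Mink d) : mink x 0 = 0 := by simp [mink]

theorem mink_neg_right (x y : Mink d) : mink x (-y) = -mink x y := by
  rw [← zero_sub, mink_sub_right, mink_zero_right, zero_sub]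

theorem mink_neg_left (x y : Mink d) : mink (-x) y = -mink x y := by
  rw [mink_comm, mink_neg_right, mink_comm]

theorem continuous_mink : Continuous fun q : Mink d × Mink d => mink q.1 q.2 := by
  unfold mink
  fun_prop

theorem Continuous.mink {Y : Type*} [TopologicalSpace Y] {f g : Y → Mink d} (hf : Continuous f)
    (hg : Continuous g) : Continuous fun y => Hyperbolic.mink (f y) (g y) :=
  continuous_mink.comp (hf.prodMk hg)

/-- The Minkowski product with a fixed vector. -/
def minkRight (y : Mink d) : Mink d →L[ℝ] ℝ :=
  LinearMap.toContinuousLinearMap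
    { toFun := fun x => mink x y
      map_add' := fun a b => mink_add_left a b y
      map_smul' := fun r a => mink_smul_left r a y }

@[simp] theorem minkRight_apply (x y : Mink d) : minkRight y x = mink x y := rfl

theorem HypSpace.norm_space_lt_time (p : HypSpace d) : ‖p.vec.2‖ < p.vec.1 := by
  have := p.sq_time
  exact lt_of_pow_lt_pow_left₀ 2 p.pos.le (by linarith)

/-- A causal vector is future pointing once its product with one point is negative. -/
theorem time_pos_of_mink_neg {x : Mink d} (hx : mink x x ≤ 0) {p : HypSpace d}
    (hp : mink x p.vec < 0) : 0 < x.1 := by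
  by_contra! h
  have hn : ‖x.2‖ ≤ -x.1 := by
    refine le_of_sq_le_sq ?_ (by linarith)
    simp only [mink, real_inner_self_eq_norm_sq] at hx
    nlinarith
  have h1 := neg_le_of_abs_le (abs_real_inner_le_norm x.2 p.vec.2)
  have h2 := p.norm_space_lt_time
  have h3 := norm_nonneg p.vec.2
  simp only [mink] at hp
  nlinarith [norm_nonneg x.2]

theorem mink_neg_of_time_pos {x : Mink d} (hx : mink x x ≤ 0) (hx1 : 0 < x.1) (p : HypSpace d) :
    mink x p.vec < 0 := by
  have hn : ‖x.2‖ ≤ x.1 := by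
    refine le_of_sq_le_sq ?_ hx1.le
    simp only [mink, real_inner_self_eq_norm_sq] at hx
    nlinarith
  have h1 := real_inner_le_norm x.2 p.vec.2
  have h2 := p.norm_space_lt_time
  have h3 := norm_nonneg p.vec.2
  simp only [mink]
  nlinarith [norm_nonneg x.2]

/-! ### Topology of hyperbolic space -/

theorem HypSpace.cosh_dist (x y : HypSpace d) : Real.cosh (dist x y) = -mink x.vec y.vec := by
  rw [HypSpace.dist_def, Real.cosh_arcosh (x.one_le_neg_mink y)]

/-- The point of hyperbolic space with given space coordinate. -/
def HypSpace.ofSpace (u : EuclideanSpace ℝ (Fin d)) : HypSpace d where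
  vec := (√(1 + ‖u‖ ^ 2), u)
  mink_self := by
    simp only [mink, real_inner_self_eq_norm_sq]
    rw [Real.mul_self_sqrt (by positivity)]
    ring
  pos := Real.sqrt_pos.2 (by positivity)

theorem HypSpace.continuous_mink_vec_hyp (y : HypSpace d) :
    Continuous fun x : HypSpace d => mink x.vec y.vec := by
  have : (fun x : HypSpace d => mink x.vec y.vec) = fun x => -Real.cosh (dist x y) := by
    funext x
    rw [x.cosh_dist, neg_neg]
  rw [this]
  exact (Real.continuous_cosh.comp (continuous_id.dist continuous_const)).neg

/-- Products with a fixed point of the hyperboloid are -cosh of a distance, hence continuous.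
Finitely many of them determine all coordinates: the point over 0 gives the time coordinate, the
points over the standard basis vectors give the others. -/
theorem HypSpace.continuous_vec : Continuous (HypSpace.vec : HypSpace d → Mink d) := by
  have h1 : Continuous fun x : HypSpace d => x.vec.1 := by
    have := (HypSpace.continuous_mink_vec_hyp (HypSpace.ofSpace (0 : EuclideanSpace ℝ (Fin d)))).neg
    exact this.congr fun x => by simp [mink, HypSpace.ofSpace]
  refine h1.prodMk ((PiLp.homeomorph 2 _).comp_continuous_iff.1 (continuous_pi fun i => ?_))
  set y := HypSpace.ofSpace (EuclideanSpace.single i (1 : ℝ)) with hy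
  have : Continuous fun x : HypSpace d => mink x.vec y.vec + x.vec.1 * y.vec.1 :=
    (HypSpace.continuous_mink_vec_hyp y).add (h1.mul continuous_const)
  refine this.congr fun x => ?_
  simp [mink, hy, HypSpace.ofSpace, EuclideanSpace.inner_single_right, PiLp.homeomorph]

theorem HypSpace.continuous_iff {Y : Type*} [TopologicalSpace Y] {g : Y → HypSpace d} :
    Continuous g ↔ Continuous fun y => (g y).vec := by
  refine ⟨fun h => HypSpace.continuous_vec.comp h, fun h => continuous_iff_continuousAt.2
    fun y₀ => ?_⟩
  rw [ContinuousAt, tendsto_iff_dist_tendsto_zero]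
  have h1 : Continuous fun y => -mink (g y).vec (g y₀).vec :=
    (Continuous.mink h continuous_const).neg
  have h2 : ContinuousOn Real.arcosh (Ici 1) := Real.continuousOn_arcosh
  have h3 : Continuous fun y => Real.arcosh (-mink (g y).vec (g y₀).vec) :=
    h2.comp_continuous h1 fun y => (g y).one_le_neg_mink (g y₀)
  have := h3.tendsto y₀
  simpa [(g y₀).mink_self, HypSpace.dist_def] using this

/-- The orthogonal complement of a point of hyperbolic space is positive definite. -/
theorem HypSpace.eq_zero_of_mink_self_nonpos (p : HypSpace d) {v : Mink d}
    (hv : mink v p.vec = 0) (h : mink v v ≤ 0) : v = 0 := by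
  have hp := p.sq_time
  have h1 : inner ℝ v.2 p.vec.2 = v.1 * p.vec.1 := by
    simp only [mink] at hv
    linarith
  have h2 : (v.1 * p.vec.1) ^ 2 ≤ (‖v.2‖ * ‖p.vec.2‖) ^ 2 := by
    rw [← h1]
    exact sq_le_sq' (neg_le_of_abs_le (abs_real_inner_le_norm _ _)) (real_inner_le_norm _ _)
  simp only [mink, real_inner_self_eq_norm_sq] at h
  rw [mul_pow, mul_pow, hp] at h2
  have h3 : ‖v.2‖ ^ 2 ≤ 0 := by nlinarith [sq_nonneg ‖p.vec.2‖]
  have h4 : v.2 = 0 := by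
    rw [← norm_eq_zero]
    exact pow_eq_zero_iff two_ne_zero |>.1 (le_antisymm h3 (sq_nonneg _))
  have h5 : v.1 = 0 := by
    rw [h4, inner_zero_left] at h1
    exact (mul_eq_zero.1 h1.symm).resolve_right p.pos.ne'
  exact Prod.ext h5 h4

/-- The point of hyperbolic space with a given timelike unit position vector. -/
theorem exists_hypSpace_vec_eq {x : Mink d} (hx : mink x x = -1) {p : HypSpace d}
    (hp : mink x p.vec < 0) : ∃ q : HypSpace d, q.vec = x :=
  ⟨⟨x, hx, time_pos_of_mink_neg (by linarith) hp⟩, rfl⟩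

/-! ### Frames of the orthogonal complement of a point and a normal vector -/

/-- An isometric identification of Euclidean space with the orthogonal complement of the position
vector `p` and of a unit tangent vector `n` at `p`. -/
structure TangentFrame (p : HypSpace d) (n : Mink d) where
  /-- the inclusion into Minkowski space -/
  incl : EuclideanSpace ℝ (Fin (d - 1)) →L[ℝ] Mink d
  /-- the orthogonal projection -/
  proj : Mink d →L[ℝ] EuclideanSpace ℝ (Fin (d - 1))
  mink_incl : ∀ a b, mink (incl a) (incl b) = inner ℝ a b
  mink_incl_base : ∀ a, mink (incl a) p.vec = 0
  mink_incl_normal : ∀ a, mink (incl a) n = 0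
  inner_proj : ∀ x a, inner ℝ (proj x) a = mink x (incl a)
  mink_normal : mink n n = 1
  mink_normal_base : mink n p.vec = 0
  exists_incl_eq : ∀ x, mink x p.vec = 0 → mink x n = 0 → ∃ a, incl a = x

/-- The orthogonal complement of p and n has dimension (d + 1) - 2, and the Minkowski form is
positive definite on it because it is orthogonal to the timelike p. An orthogonal basis can
therefore be normalised to an orthonormal one. -/
theorem exists_tangentFrame (hd : 2 ≤ d) (p : HypSpace d) {n : Mink d} (hn : mink n n = 1)
    (hnp : mink n p.vec = 0) : Nonempty (TangentFrame p n) := by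
  let L : Mink d →ₗ[ℝ] ℝ × ℝ := ((minkRight p.vec).prod (minkRight n)).toLinearMap
  have hL : ∀ x, L x = (mink x p.vec, mink x n) := fun x => rfl
  have hsurj : LinearMap.range L = ⊤ := by
    refine LinearMap.range_eq_top.2 fun ⟨a, b⟩ => ⟨(-a) • p.vec + b • n, ?_⟩
    rw [hL, mink_add_left, mink_add_left, mink_smul_left, mink_smul_left, mink_smul_left,
      mink_smul_left, p.mink_self, hnp, mink_comm p.vec n, hnp, hn]
    simp
  set T := LinearMap.ker L with hT
  have hdim : Module.finrank ℝ T = d - 1 := by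
    have := LinearMap.finrank_range_add_finrank_ker L
    rw [hsurj, ← hT, finrank_top, Module.finrank_prod, Module.finrank_prod, Module.finrank_self,
      finrank_euclideanSpace, Fintype.card_fin] at this
    omega
  let B : LinearMap.BilinForm ℝ T := LinearMap.mk₂ ℝ (fun x y => mink (x : Mink d) y)
    (fun a b c => mink_add_left _ _ _) (fun r a b => mink_smul_left _ _ _)
    (fun a b c => mink_add_right _ _ _) (fun r a b => mink_smul_right _ _ _)
  have hB : ∀ x y, B x y = mink (x : Mink d) y := fun x y => rfl
  have hTmem : ∀ x : T, mink (x : Mink d) p.vec = 0 ∧ mink (x : Mink d) n = 0 := fun x => by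
    have := LinearMap.mem_ker.1 x.2
    rw [hL, Prod.mk_eq_zero] at this
    exact this
  have hBsymm : LinearMap.IsSymm B := ⟨fun x y => by simp [hB, mink_comm]⟩
  obtain ⟨v₀, hv₀⟩ := LinearMap.BilinForm.exists_orthogonal_basis (K := ℝ) (V := T) (B := B) hBsymm
  let v := v₀.reindex (finCongr hdim)
  have hpos : ∀ i, 0 < mink (v i : Mink d) (v i) := fun i => by
    by_contra! h
    exact v.ne_zero i (Subtype.ext (p.eq_zero_of_mink_self_nonpos (hTmem (v i)).1 h))
  have horth : ∀ i j, i ≠ j → mink (v i : Mink d) (v j) = 0 := fun i j hij => by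
    have := hv₀ (i := (finCongr hdim).symm i) (j := (finCongr hdim).symm j) (by simpa using hij)
    simpa [v, hB, Function.onFun] using this
  set c : Fin (d - 1) → ℝ := fun i => √(mink (v i : Mink d) (v i)) with hc
  have hcpos : ∀ i, 0 < c i := fun i => Real.sqrt_pos.2 (hpos i)
  set e : Fin (d - 1) → Mink d := fun i => (c i)⁻¹ • (v i : Mink d) with he
  have heT : ∀ i, mink (e i) p.vec = 0 ∧ mink (e i) n = 0 := fun i => by
    simp only [he, mink_smul_left, (hTmem (v i)).1, (hTmem (v i)).2, mul_zero, and_self]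
  have hee : ∀ i j, mink (e i) (e j) = if i = j then 1 else 0 := fun i j => by
    simp only [he, mink_smul_left, mink_smul_right]
    split_ifs with hij
    · subst hij
      have := Real.mul_self_sqrt (hpos i).le
      have h1 := (hcpos i).ne'
      field_simp
      rw [← this, sq]
    · rw [horth i j hij, mul_zero, mul_zero]
  let incl : EuclideanSpace ℝ (Fin (d - 1)) →ₗ[ℝ] Mink d :=
    { toFun := fun a => ∑ i, a i • e i
      map_add' := fun a b => by simp [add_smul, Finset.sum_add_distrib]
      map_smul' := fun r a => by simp [Finset.smul_sum, mul_smul] }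
  let proj : Mink d →ₗ[ℝ] EuclideanSpace ℝ (Fin (d - 1)) :=
    { toFun := fun x => WithLp.toLp 2 fun i => mink x (e i)
      map_add' := fun a b => by
        ext i
        simp [mink_add_left]
      map_smul' := fun r a => by
        ext i
        simp [mink_smul_left] }
  have hincl : ∀ a, incl a = ∑ i, a i • e i := fun a => rfl
  have hproj : ∀ x i, proj x i = mink x (e i) := fun x i => rfl
  have hsum : ∀ a y, mink (incl a) y = ∑ i, a i * mink (e i) y := fun a y => by
    rw [← minkRight_apply, hincl, map_sum]
    simp
  refine ⟨⟨incl.toContinuousLinearMap, proj.toContinuousLinearMap, ?_, ?_, ?_, ?_, hn, hnp, ?_⟩⟩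
  · intro a b
    simp only [LinearMap.coe_toContinuousLinearMap', hsum, mink_comm (e _) (incl _), hee]
    simp [PiLp.inner_apply, mul_comm]
  · intro a
    simp [hsum, (heT _).1]
  · intro a
    simp [hsum, (heT _).2]
  · intro x a
    rw [LinearMap.coe_toContinuousLinearMap', LinearMap.coe_toContinuousLinearMap', mink_comm x,
      hsum, PiLp.inner_apply]
    refine Finset.sum_congr rfl fun i _ => ?_
    rw [hproj, mink_comm x]
    rfl
  · intro x hxp hxn
    have hxT : x ∈ T := LinearMap.mem_ker.2 (by rw [hL, hxp, hxn]; rfl)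
    refine ⟨WithLp.toLp 2 fun i => v.repr ⟨x, hxT⟩ i * c i, ?_⟩
    have h1 := congrArg (Subtype.val) (v.sum_repr ⟨x, hxT⟩)
    simp only [AddSubmonoidClass.coe_finsetSum, SetLike.val_smul] at h1
    simp only [LinearMap.coe_toContinuousLinearMap', hincl]
    refine Eq.trans (Finset.sum_congr rfl fun i _ => ?_) h1
    simp only [he, smul_smul]
    congr 1
    have := (hcpos i).ne'
    field_simp

namespace TangentFrame

variable {p : HypSpace d} {n : Mink d} (F : TangentFrame p n)

@[simp] theorem proj_incl (a : EuclideanSpace ℝ (Fin (d - 1))) : F.proj (F.incl a) = a :=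
  ext_inner_right ℝ fun b => by rw [F.inner_proj, F.mink_incl]

@[simp] theorem proj_base : F.proj p.vec = 0 :=
  ext_inner_right ℝ fun b => by
    rw [F.inner_proj, mink_comm, F.mink_incl_base, inner_zero_left]

@[simp] theorem proj_normal : F.proj n = 0 :=
  ext_inner_right ℝ fun b => by
    rw [F.inner_proj, mink_comm, F.mink_incl_normal, inner_zero_left]

theorem incl_proj {x : Mink d} (hp : mink x p.vec = 0) (hn : mink x n = 0) :
    F.incl (F.proj x) = x := by
  obtain ⟨a, rfl⟩ := F.exists_incl_eq x hp hn
  rw [F.proj_incl]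

end TangentFrame

/-! ### Conformal charts of umbilic level sets -/

/-- The section of hyperbolic space by the affine hyperplane `⟨x, w⟩ = -lam`. -/
def umbilicLevel (w : Mink d) (lam : ℝ) : Set (HypSpace d) := {x | mink x.vec w = -lam}

namespace TangentFrame

variable {p : HypSpace d} {n : Mink d} (F : TangentFrame p n) (lam : ℝ)

/-- The domain of the stereographic chart. -/
def stereoDomain (d : ℕ) (lam : ℝ) : Set (EuclideanSpace ℝ (Fin (d - 1))) :=
  {a | (1 - lam ^ 2) * ‖a‖ ^ 2 < 4}

/-- The conformal factor of the stereographic chart. -/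
def factor (lam : ℝ) (a : EuclideanSpace ℝ (Fin (d - 1))) : ℝ :=
  conformalFactor (1 - lam ^ 2) ‖a‖

/-- The height of the stereographic image of `a` over the tangent space. -/
def height (lam : ℝ) (a : EuclideanSpace ℝ (Fin (d - 1))) : ℝ := factor lam a * ‖a‖ ^ 2 / 2

/-- The stereographic parametrization of an umbilic level set through `p` with normal `n`, as a map
into Minkowski space. -/
def stereoVec (a : EuclideanSpace ℝ (Fin (d - 1))) : Mink d :=
  p.vec + factor lam a • F.incl a + height lam a • (p.vec + lam • n)

open Classical in
/-- The stereographic parametrization of an umbilic level set through `p` with normal `n`. -/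
def stereo (a : EuclideanSpace ℝ (Fin (d - 1))) : HypSpace d :=
  if h : ∃ q : HypSpace d, q.vec = F.stereoVec lam a then h.choose else p

/-- The stereographic chart. -/
def chart (x : Mink d) : EuclideanSpace ℝ (Fin (d - 1)) :=
  (1 + (1 - lam ^ 2) * (-1 - mink x p.vec) / 2)⁻¹ • F.proj x

variable {lam}

theorem factor_pos {a : EuclideanSpace ℝ (Fin (d - 1))} (ha : a ∈ stereoDomain d lam) :
    0 < factor lam a := conformalFactor_pos ha

theorem factor_mul {a : EuclideanSpace ℝ (Fin (d - 1))} (ha : a ∈ stereoDomain d lam) :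
    factor lam a * (4 - (1 - lam ^ 2) * ‖a‖ ^ 2) = 4 :=
  div_mul_cancel₀ _ (sub_pos.2 ha).ne'

theorem height_nonneg {a : EuclideanSpace ℝ (Fin (d - 1))} (ha : a ∈ stereoDomain d lam) :
    0 ≤ height lam a := by
  have := factor_pos ha
  unfold height
  positivity

theorem isOpen_stereoDomain : IsOpen (stereoDomain d lam) :=
  isOpen_lt (by fun_prop) continuous_const

theorem convex_stereoDomain (hlam : lam ^ 2 ≤ 1) : Convex ℝ (stereoDomain d lam) := by
  have h : ConvexOn ℝ univ fun a : EuclideanSpace ℝ (Fin (d - 1)) => (1 - lam ^ 2) * ‖a‖ ^ 2 :=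
    ConvexOn.smul (by linarith : 0 ≤ 1 - lam ^ 2)
      ((convexOn_norm convex_univ).pow (fun _ _ => norm_nonneg _) 2)
  simpa [stereoDomain] using h.convex_lt 4

theorem zero_mem_stereoDomain : (0 : EuclideanSpace ℝ (Fin (d - 1))) ∈ stereoDomain d lam := by
  simp [stereoDomain]

theorem mink_stereoVec_base (a : EuclideanSpace ℝ (Fin (d - 1))) :
    mink (F.stereoVec lam a) p.vec = -1 - height lam a := by
  simp only [stereoVec, mink_add_left, mink_smul_left, F.mink_incl_base, p.mink_self,
    F.mink_normal_base]
  ring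

theorem mink_stereoVec_normal (a : EuclideanSpace ℝ (Fin (d - 1))) :
    mink (F.stereoVec lam a) n = lam * height lam a := by
  simp only [stereoVec, mink_add_left, mink_smul_left, F.mink_incl_normal, F.mink_normal,
    mink_comm p.vec n, F.mink_normal_base]
  ring

/-- The conformality of stereographic projection in global form. It reduces to c(a) - 1 = (1 - λ²)
c(a)|a|²/4, which is the defining relation of the conformal factor. -/
theorem mink_stereoVec {a b : EuclideanSpace ℝ (Fin (d - 1))} (ha : a ∈ stereoDomain d lam)
    (hb : b ∈ stereoDomain d lam) :
    mink (F.stereoVec lam a) (F.stereoVec lam b) =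
      -1 - factor lam a * factor lam b * ‖a - b‖ ^ 2 / 2 := by
  have hi : ∀ c, mink p.vec (F.incl c) = 0 := fun c => by rw [mink_comm, F.mink_incl_base]
  have hn : ∀ c, mink n (F.incl c) = 0 := fun c => by rw [mink_comm, F.mink_incl_normal]
  have hA := factor_mul ha
  have hB := factor_mul hb
  rw [norm_sub_sq_real]
  simp only [stereoVec, mink_add_left, mink_add_right, mink_smul_left, mink_smul_right, hi, hn,
    F.mink_incl_normal, F.mink_incl_base, F.mink_incl, F.mink_normal, F.mink_normal_base,
    mink_comm p.vec n, p.mink_self, height]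
  set A := factor lam a
  set B := factor lam b
  linear_combination (A * ‖a‖ ^ 2 / 8) * hB + (B * ‖b‖ ^ 2 / 8) * hA

theorem stereo_vec {a : EuclideanSpace ℝ (Fin (d - 1))} (ha : a ∈ stereoDomain d lam) :
    (F.stereo lam a).vec = F.stereoVec lam a := by
  have h : ∃ q : HypSpace d, q.vec = F.stereoVec lam a := by
    refine exists_hypSpace_vec_eq (p := p) ?_ ?_
    · rw [F.mink_stereoVec ha ha]
      simp
    · rw [F.mink_stereoVec_base]
      linarith [height_nonneg ha]
  rw [stereo, dif_pos h]
  exact h.choose_spec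

theorem stereo_zero : F.stereo lam 0 = p := by
  refine HypSpace.ext ?_
  rw [F.stereo_vec zero_mem_stereoDomain]
  simp [stereoVec, height]

theorem stereo_mem {a : EuclideanSpace ℝ (Fin (d - 1))} (ha : a ∈ stereoDomain d lam) :
    F.stereo lam a ∈ umbilicLevel (n + lam • p.vec) lam := by
  rw [umbilicLevel, mem_ofPred_eq, F.stereo_vec ha, mink_add_right, mink_smul_right,
    mink_stereoVec_base, mink_stereoVec_normal]
  ring

theorem chart_stereoVec {a : EuclideanSpace ℝ (Fin (d - 1))} (ha : a ∈ stereoDomain d lam) :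
    F.chart lam (F.stereoVec lam a) = a := by
  have h1 : F.proj (F.stereoVec lam a) = factor lam a • a := by
    simp [stereoVec]
  have h2 : 1 + (1 - lam ^ 2) * (-1 - mink (F.stereoVec lam a) p.vec) / 2 = factor lam a := by
    rw [mink_stereoVec_base, height]
    linear_combination (-1 / 4) * factor_mul ha
  rw [chart, h1, h2, smul_smul, inv_mul_cancel₀ (factor_pos ha).ne', one_smul]

theorem chart_stereo {a : EuclideanSpace ℝ (Fin (d - 1))} (ha : a ∈ stereoDomain d lam) :
    F.chart lam (F.stereo lam a).vec = a := by
  rw [F.stereo_vec ha, F.chart_stereoVec ha]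

theorem chart_denom_pos (hlam : lam ^ 2 ≤ 1) (x : HypSpace d) :
    0 < 1 + (1 - lam ^ 2) * (-1 - mink x.vec p.vec) / 2 := by
  have := x.one_le_neg_mink p
  have : 0 ≤ (1 - lam ^ 2) * (-1 - mink x.vec p.vec) :=
    mul_nonneg (by linarith) (by linarith)
  linarith

/-- With b the height of x over p, the vector x - p - b (p + λn) is orthogonal to p and n, so it
comes from the frame. Its length is forced by ⟨x,x⟩ = -1, and from it the conformal factor and
height at the chart image are computed to be g and b. -/
theorem chart_mem_and_stereoVec_chart (hlam : lam ^ 2 ≤ 1) {x : HypSpace d}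
    (hx : x ∈ umbilicLevel (n + lam • p.vec) lam) :
    F.chart lam x.vec ∈ stereoDomain d lam ∧ F.stereoVec lam (F.chart lam x.vec) = x.vec := by
  set b := -1 - mink x.vec p.vec with hb
  set g := 1 + (1 - lam ^ 2) * b / 2 with hg
  have hg0 : 0 < g := chart_denom_pos hlam x
  have hxn : mink x.vec n = lam * b := by
    have : mink x.vec (n + lam • p.vec) = -lam := hx
    rw [mink_add_right, mink_smul_right] at this
    linarith
  set y := F.proj x.vec with hy
  have hxy : F.incl y = x.vec - p.vec - b • (p.vec + lam • n) := by
    have : y = F.proj (x.vec - p.vec - b • (p.vec + lam • n)) := by simp [hy]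
    rw [this]
    refine F.incl_proj ?_ ?_
    · simp only [mink_sub_left, mink_add_left, mink_smul_left, p.mink_self, F.mink_normal_base]
      linarith
    · simp only [mink_sub_left, mink_add_left, mink_smul_left, F.mink_normal,
        mink_comm p.vec n, F.mink_normal_base, hxn]
      ring
  have hxp : mink x.vec p.vec = -1 - b := by linarith
  have hyn : ‖y‖ ^ 2 = (1 - lam ^ 2) * b ^ 2 + 2 * b := by
    rw [← real_inner_self_eq_norm_sq, ← F.mink_incl, hxy]
    simp only [mink_sub_left, mink_sub_right, mink_add_left, mink_add_right, mink_smul_left,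
      mink_smul_right, p.mink_self, x.mink_self, F.mink_normal, mink_comm p.vec n,
      F.mink_normal_base, mink_comm p.vec x.vec, mink_comm n x.vec, hxn, hxp]
    ring
  have hch : F.chart lam x.vec = g⁻¹ • y := rfl
  have hcn : ‖F.chart lam x.vec‖ ^ 2 = 2 * b / g := by
    rw [hch, norm_smul, mul_pow, hyn, Real.norm_eq_abs, sq_abs]
    field_simp
    rw [hg]
    ring
  have hmem : F.chart lam x.vec ∈ stereoDomain d lam := by
    rw [stereoDomain, mem_ofPred_eq, hcn, ← mul_div_assoc, div_lt_iff₀ hg0]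
    rw [hg]
    linarith
  have hfac : factor lam (F.chart lam x.vec) = g := by
    have h4 : 4 - (1 - lam ^ 2) * ‖F.chart lam x.vec‖ ^ 2 = 4 / g := by
      rw [hcn]
      field_simp
      rw [hg]
      ring
    rw [factor, conformalFactor, h4]
    field_simp
  have hh : height lam (F.chart lam x.vec) = b := by
    rw [height, hfac, hcn]
    field_simp
  refine ⟨hmem, ?_⟩
  rw [stereoVec, hh, hfac, hch, map_smul, smul_smul, mul_inv_cancel₀ hg0.ne', one_smul, hxy]
  abel

theorem stereo_chart (hlam : lam ^ 2 ≤ 1) {x : HypSpace d}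
    (hx : x ∈ umbilicLevel (n + lam • p.vec) lam) : F.stereo lam (F.chart lam x.vec) = x := by
  obtain ⟨h1, h2⟩ := F.chart_mem_and_stereoVec_chart hlam hx
  exact HypSpace.ext ((F.stereo_vec h1).trans h2)

theorem injOn_stereo : InjOn (F.stereo lam) (stereoDomain d lam) := fun a ha b hb hab => by
  rw [← F.chart_stereo ha, hab, F.chart_stereo hb]

/-- Rewrites the product identity through cosh D - 1 = 2 sinh² (D / 2). As b tends to a, the
distance becomes c(a)|a - b| to first order. -/
theorem sq_two_mul_sinh_half_dist {a b : EuclideanSpace ℝ (Fin (d - 1))}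
    (ha : a ∈ stereoDomain d lam) (hb : b ∈ stereoDomain d lam) :
    (2 * Real.sinh (dist (F.stereo lam a) (F.stereo lam b) / 2)) ^ 2 =
      factor lam a * factor lam b * ‖a - b‖ ^ 2 := by
  have h := (F.stereo lam a).cosh_dist (F.stereo lam b)
  rw [F.stereo_vec ha, F.stereo_vec hb, F.mink_stereoVec ha hb] at h
  have h2 := Real.cosh_two_mul (dist (F.stereo lam a) (F.stereo lam b) / 2)
  rw [mul_div_cancel₀ _ two_ne_zero, h, Real.cosh_sq] at h2
  linarith

theorem contDiffAt_stereoVec {a : EuclideanSpace ℝ (Fin (d - 1))} (ha : a ∈ stereoDomain d lam) :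
    ContDiffAt ℝ ∞ (F.stereoVec lam) a := by
  have hn : ContDiff ℝ ∞ fun b : EuclideanSpace ℝ (Fin (d - 1)) => ‖b‖ ^ 2 := contDiff_norm_sq ℝ
  have hf : ContDiffAt ℝ ∞ (factor lam) a :=
    ContDiffAt.div contDiffAt_const (contDiffAt_const.sub (contDiffAt_const.mul hn.contDiffAt))
      (sub_pos.2 ha).ne'
  have hh : ContDiffAt ℝ ∞ (height lam) a := (hf.mul hn.contDiffAt).div_const 2
  exact (contDiffAt_const.add (hf.smul F.incl.contDiff.contDiffAt)).add (hh.smul contDiffAt_const)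

theorem contDiffAt_chart (hlam : lam ^ 2 ≤ 1) (x : HypSpace d) :
    ContDiffAt ℝ ∞ (F.chart lam) x.vec := by
  have h1 : ContDiff ℝ ∞ fun y : Mink d => mink y p.vec := (minkRight p.vec).contDiff
  have h2 : ContDiffAt ℝ ∞ (fun y : Mink d => 1 + (1 - lam ^ 2) * (-1 - mink y p.vec) / 2) x.vec :=
    contDiffAt_const.add
      ((contDiffAt_const.mul (contDiffAt_const.sub h1.contDiffAt)).div_const 2)
  exact (h2.inv (chart_denom_pos hlam x).ne').smul F.proj.contDiff.contDiffAt

theorem continuousOn_factor : ContinuousOn (factor lam) (stereoDomain d lam) :=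
  ContinuousOn.div (by fun_prop) (by fun_prop) fun _ ha => (sub_pos.2 ha).ne'

end TangentFrame

namespace TangentFrame

variable {p : HypSpace d} {n : Mink d} (F : TangentFrame p n) {lam : ℝ}

theorem continuousOn_stereo : ContinuousOn (F.stereo lam) (stereoDomain d lam) := by
  rw [continuousOn_iff_continuous_domRestrict, HypSpace.continuous_iff]
  have h : ContinuousOn (F.stereoVec lam) (stereoDomain d lam) := fun a ha =>
    (F.contDiffAt_stereoVec ha).continuousAt.continuousWithinAt
  refine (continuousOn_iff_continuous_domRestrict.1 h).congr fun a => ?_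
  exact (F.stereo_vec a.2).symm

/-! ### Radial curves and the intrinsic distance -/

theorem smul_modelRadius_mem (hlam : lam ^ 2 ≤ 1) {u : EuclideanSpace ℝ (Fin (d - 1))}
    (hu : ‖u‖ = 1) (t : ℝ) : modelRadius √(1 - lam ^ 2) t • u ∈ stereoDomain d lam := by
  have := sq_mul_sq_modelRadius_lt √(1 - lam ^ 2) t
  rw [Real.sq_sqrt (by linarith)] at this
  rwa [stereoDomain, mem_ofPred_eq, norm_smul, hu, mul_one, Real.norm_eq_abs, sq_abs]

theorem dist_stereo_radial_le (hlam : lam ^ 2 ≤ 1) {u : EuclideanSpace ℝ (Fin (d - 1))}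
    (hu : ‖u‖ = 1) (s t : ℝ) :
    dist (F.stereo lam (modelRadius √(1 - lam ^ 2) s • u))
      (F.stereo lam (modelRadius √(1 - lam ^ 2) t • u)) ≤ |s - t| := by
  set m := √(1 - lam ^ 2) with hm
  have hm2 : m ^ 2 = 1 - lam ^ 2 := Real.sq_sqrt (by linarith)
  have hm0 : 0 ≤ m := Real.sqrt_nonneg _
  have hm1 : m ≤ 1 := by nlinarith [sq_nonneg lam]
  have hf : ∀ t, factor lam (modelRadius m t • u) = conformalFactor (m ^ 2) (modelRadius m t) :=
    fun t => by
      rw [factor, conformalFactor, conformalFactor, norm_smul, hu, mul_one, Real.norm_eq_abs,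
        sq_abs, hm2]
  have h := F.sq_two_mul_sinh_half_dist (smul_modelRadius_mem hlam hu s)
    (smul_modelRadius_mem hlam hu t)
  rw [← hm, hf, hf, ← sub_smul, norm_smul, hu, mul_one, Real.norm_eq_abs, sq_abs,
    conformalFactor_mul_sq_sub] at h
  have h1 : 2 * Real.sinh (dist (F.stereo lam (modelRadius m s • u))
      (F.stereo lam (modelRadius m t • u)) / 2) ≤ |chordLength m (s - t)| :=
    le_of_sq_le_sq (by rw [sq_abs, h]) (abs_nonneg _)
  have h2 := h1.trans (abs_chordLength_le hm0 hm1 (s - t))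
  have h3 := Real.sinh_le_sinh.1 ((mul_le_mul_iff_right₀ two_pos).1 h2)
  linarith

/-- Since ||a| - |b|| ≤ |a - b|, points on a common ray are the extreme case, and there the chord is
at least the difference of radii. So the radial coordinate is infinitesimally 1-Lipschitz. -/
theorem abs_intrinsicRadius_sub_le (hlam : lam ^ 2 ≤ 1) {a b : EuclideanSpace ℝ (Fin (d - 1))}
    (ha : a ∈ stereoDomain d lam) (hb : b ∈ stereoDomain d lam) :
    |intrinsicRadius √(1 - lam ^ 2) ‖a‖ - intrinsicRadius √(1 - lam ^ 2) ‖b‖| ≤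
      2 * Real.sinh (dist (F.stereo lam a) (F.stereo lam b) / 2) := by
  set m := √(1 - lam ^ 2) with hm
  have hm2 : m ^ 2 = 1 - lam ^ 2 := Real.sq_sqrt (by linarith)
  have hm0 : 0 ≤ m := Real.sqrt_nonneg _
  have hsinh : 0 ≤ Real.sinh (dist (F.stereo lam a) (F.stereo lam b) / 2) :=
    Real.sinh_nonneg_iff.2 (by positivity)
  refine (abs_le_abs_chordLength hm0 _).trans (abs_le_of_sq_le_sq ?_ (by positivity))
  rw [F.sq_two_mul_sinh_half_dist ha hb, ← conformalFactor_mul_sq_sub,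
    modelRadius_intrinsicRadius hm0 (norm_nonneg a) (by rw [hm2]; exact ha),
    modelRadius_intrinsicRadius hm0 (norm_nonneg b) (by rw [hm2]; exact hb), hm2]
  have h1 := factor_pos ha
  have h2 := factor_pos hb
  have h3 : (‖a‖ - ‖b‖) ^ 2 ≤ ‖a - b‖ ^ 2 := by
    rw [← sq_abs]
    exact pow_le_pow_left₀ (abs_nonneg _) (abs_norm_sub_norm_le a b) 2
  exact mul_le_mul_of_nonneg_left h3 (mul_pos h1 h2).le

/-- The radial curve bounds the distance from above, and the 1-Lipschitz radial coordinate bounds it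
from below. -/
theorem lengthEDist_stereo (hlam : lam ^ 2 ≤ 1) {H : Set (HypSpace d)}
    (hH : H = umbilicLevel (n + lam • p.vec) lam) {c x : H} (hc : (c : HypSpace d) = p)
    {a : EuclideanSpace ℝ (Fin (d - 1))} (ha : a ∈ stereoDomain d lam)
    (hx : (x : HypSpace d) = F.stereo lam a) :
    lengthEDist c x = ENNReal.ofReal (intrinsicRadius √(1 - lam ^ 2) ‖a‖) := by
  set m := √(1 - lam ^ 2) with hm
  have hm2 : m ^ 2 = 1 - lam ^ 2 := Real.sq_sqrt (by linarith)
  have hm0 : 0 ≤ m := Real.sqrt_nonneg _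
  set r := intrinsicRadius m ‖a‖ with hr
  have hr0 : 0 ≤ r := intrinsicRadius_nonneg hm0 (norm_nonneg a)
  apply le_antisymm
  · rcases eq_or_ne a 0 with rfl | ha0
    · have : x = c := Subtype.ext (by rw [hx, hc, F.stereo_zero])
      rw [this]
      refine (iInf_le _ (Path.refl c)).trans ?_
      rw [eVariationOn.constant_on]
      · exact zero_le
      · rintro _ ⟨i, -, rfl⟩ _ ⟨j, -, rfl⟩
        rfl
    · set u := ‖a‖⁻¹ • a with hu
      have hna : ‖a‖ ≠ 0 := norm_ne_zero_iff.2 ha0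
      have hu1 : ‖u‖ = 1 := norm_smul_inv_norm ha0
      have hau : modelRadius m r • u = a := by
        rw [hr, modelRadius_intrinsicRadius hm0 (norm_nonneg a) (by rw [hm2]; exact ha), hu,
          smul_smul, mul_inv_cancel₀ hna, one_smul]
      have key := lengthEDist_le_of_lipschitz (H := H)
        (γ := fun t => F.stereo lam (modelRadius m t • u)) hr0
        (fun s _ t _ => F.dist_stereo_radial_le hlam hu1 s t)
        (fun t _ => hH ▸ F.stereo_mem (smul_modelRadius_mem hlam hu1 t))
      rw [sub_zero] at key
      refine le_trans (le_of_eq (congrArg₂ _ (Subtype.ext ?_) (Subtype.ext ?_))) key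
      · show (c : HypSpace d) = F.stereo lam (modelRadius m 0 • u)
        rw [hc, modelRadius_zero, zero_smul, F.stereo_zero]
      · show (x : HypSpace d) = F.stereo lam (modelRadius m r • u)
        rw [hx, hau]
  · have hmem : ∀ y : H, (y : HypSpace d) ∈ umbilicLevel (n + lam • p.vec) lam := fun y =>
      hH ▸ y.2
    have key := ofReal_abs_sub_le_lengthEDist (X := H)
      (G := fun y => intrinsicRadius m ‖F.chart lam (y : HypSpace d).vec‖) (fun y z => by
        have h := F.abs_intrinsicRadius_sub_le hlam (F.chart_mem_and_stereoVec_chart hlam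
          (hmem y)).1 (F.chart_mem_and_stereoVec_chart hlam (hmem z)).1
        rwa [F.stereo_chart hlam (hmem y), F.stereo_chart hlam (hmem z)] at h) c x
    have h1 : F.chart lam (c : HypSpace d).vec = 0 := by
      rw [hc, chart, F.proj_base, smul_zero]
    have h2 : F.chart lam (x : HypSpace d).vec = a := by rw [hx, F.chart_stereo ha]
    have h3 : intrinsicRadius m 0 = 0 := by simp [intrinsicRadius]
    simp only [h1, h2, norm_zero, h3, zero_sub, abs_neg] at key
    rwa [abs_of_nonneg hr0] at key

/-! ### Area -/

theorem exists_nhds_stereo_conformal {x : EuclideanSpace ℝ (Fin (d - 1))}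
    (hx : x ∈ stereoDomain d lam) {t : ℝ} (ht : 1 < t) :
    ∃ U ∈ 𝓝 x, ∀ a ∈ U, ∀ b ∈ U,
      dist (F.stereo lam a) (F.stereo lam b) ≤ t * factor lam x * dist a b ∧
        factor lam x * dist a b ≤ t * dist (F.stereo lam a) (F.stereo lam b) := by
  -- The allowed factor t is split in two: one √t for the variation of the conformal factor, one for
  -- replacing 2 sinh (D / 2) by D. The upper bound needs only the first, as D ≤ 2 sinh (D / 2).
  set q := √t with hq
  have hq1 : 1 < q := Real.lt_sqrt_of_sq_lt (by simpa using ht)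
  have hq0 : 0 < q := by linarith
  have hqt : q * q = t := Real.mul_self_sqrt (by linarith)
  have hfx := factor_pos hx
  obtain ⟨δ, hδ, hsinh⟩ := exists_two_mul_sinh_half_le hq1
  have hfc : ContinuousAt (factor lam) x :=
    continuousOn_factor.continuousAt (isOpen_stereoDomain.mem_nhds hx)
  have e1 : ∀ᶠ a in 𝓝 x, factor lam x / q < factor lam a :=
    hfc.eventually_const_lt (div_lt_self hfx hq1)
  have e2 : ∀ᶠ a in 𝓝 x, factor lam a < q * factor lam x :=
    hfc.eventually_lt_const (by nlinarith)
  have e3 : ∀ᶠ a in 𝓝 x, dist (F.stereo lam a) (F.stereo lam x) < δ / 2 :=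
    (F.continuousOn_stereo.continuousAt (isOpen_stereoDomain.mem_nhds hx)).eventually
      (Metric.ball_mem_nhds _ (by positivity))
  refine ⟨_, inter_mem (isOpen_stereoDomain.mem_nhds hx) (e1.and (e2.and e3)), ?_⟩
  rintro a ⟨ha, ha1, ha2, ha3⟩ b ⟨hb, hb1, hb2, hb3⟩
  set D := dist (F.stereo lam a) (F.stereo lam b) with hD
  have hD0 : 0 ≤ D := dist_nonneg
  have hDδ : D < δ := by
    have := dist_triangle_right (F.stereo lam a) (F.stereo lam b) (F.stereo lam x)
    linarith
  have h1 : D ≤ 2 * Real.sinh (D / 2) := by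
    have := Real.self_le_sinh_iff.2 (show 0 ≤ D / 2 by positivity)
    linarith
  have h2 := hsinh D hD0 hDδ
  have hsq := F.sq_two_mul_sinh_half_dist ha hb
  rw [← hD, ← dist_eq_norm] at hsq
  rw [div_lt_iff₀ hq0] at ha1 hb1
  have hfa := factor_pos ha
  have hfb := factor_pos hb
  have hdist := dist_nonneg (x := a) (y := b)
  constructor
  · have : 2 * Real.sinh (D / 2) ≤ q * factor lam x * dist a b := by
      refine le_of_sq_le_sq ?_ (by positivity)
      rw [hsq, mul_pow, sq (q * factor lam x)]
      gcongr
    have h3 : q * factor lam x * dist a b ≤ t * factor lam x * dist a b := by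
      gcongr
      nlinarith
    linarith
  · have : factor lam x * dist a b ≤ q * (2 * Real.sinh (D / 2)) := by
      refine le_of_sq_le_sq ?_ (by nlinarith)
      rw [mul_pow q, hsq, mul_pow]
      calc factor lam x ^ 2 * dist a b ^ 2
          ≤ ((factor lam a * q) * (factor lam b * q)) * dist a b ^ 2 := by
            rw [sq (factor lam x)]
            gcongr
        _ = _ := by ring
    calc factor lam x * dist a b ≤ q * (2 * Real.sinh (D / 2)) := this
      _ ≤ q * (q * D) := by gcongr
      _ = t * D := by rw [← mul_assoc, hqt]

theorem euclideanHausdorffMeasure_stereo_image {S : Set (EuclideanSpace ℝ (Fin (d - 1)))}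
    (hS : MeasurableSet S) (hSD : S ⊆ stereoDomain d lam) :
    Measure.euclideanHausdorffMeasure (d - 1) (F.stereo lam '' S) =
      ∫⁻ a in S, ENNReal.ofReal (factor lam a) ^ (d - 1) :=
  euclideanHausdorffMeasure_image_conformal continuousOn_factor (fun _ ha => factor_pos ha)
    isOpen_stereoDomain F.injOn_stereo (fun _ hx _ ht => F.exists_nhds_stereo_conformal hx ht)
    hS hSD

end TangentFrame

/-! ### Intersection of an umbilic level set with a ball -/

theorem cosh_sub_mul_sinh_pos {lam : ℝ} (h0 : 0 ≤ lam) (h1 : lam ≤ 1) (s : ℝ) :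
    0 < Real.cosh s - lam * Real.sinh s := by
  have h2 := Real.sinh_lt_cosh s
  have h3 := Real.cosh_pos s
  rcases h0.eq_or_lt with rfl | h0
  · simpa using h3
  · nlinarith [mul_pos h0 (sub_pos.2 h2)]

theorem chordLength_nonneg {m t : ℝ} (hm : 0 ≤ m) (ht : 0 ≤ t) : 0 ≤ chordLength m t := by
  unfold chordLength
  split_ifs
  · exact ht
  · exact mul_nonneg (by positivity) (Real.sinh_nonneg_iff.2 (by positivity))

theorem chordLength_le_chordLength {m t t' : ℝ} (hm : 0 ≤ m) :
    chordLength m t ≤ chordLength m t' ↔ t ≤ t' := by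
  rcases hm.eq_or_lt with rfl | hm
  · simp [chordLength]
  · rw [chordLength, chordLength, if_neg hm.ne', if_neg hm.ne',
      mul_le_mul_iff_right₀ (by positivity), Real.sinh_le_sinh,
      div_le_div_iff_of_pos_right (by norm_num), mul_le_mul_iff_right₀ hm]

theorem sq_chordLength {m : ℝ} (hm : 0 < m) (t : ℝ) :
    m ^ 2 * chordLength m t ^ 2 = 2 * (Real.cosh (m * t) - 1) := by
  have h := Real.cosh_two_mul (m * t / 2)
  rw [mul_div_cancel₀ _ two_ne_zero, Real.cosh_sq] at h
  rw [chordLength, if_neg hm.ne', h]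
  field_simp
  ring

namespace TangentFrame

variable {p : HypSpace d} {n : Mink d} (F : TangentFrame p n) {lam s : ℝ}

theorem two_mul_height (hlam : lam ^ 2 ≤ 1) {a : EuclideanSpace ℝ (Fin (d - 1))}
    (ha : a ∈ stereoDomain d lam) :
    2 * height lam a =
      chordLength √(1 - lam ^ 2) (intrinsicRadius √(1 - lam ^ 2) ‖a‖) ^ 2 := by
  set m := √(1 - lam ^ 2) with hm
  have hm2 : m ^ 2 = 1 - lam ^ 2 := Real.sq_sqrt (by linarith)
  have h := conformalFactor_mul_sq_sub m (intrinsicRadius m ‖a‖) 0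
  rw [modelRadius_intrinsicRadius (Real.sqrt_nonneg _) (norm_nonneg a) (by rw [hm2]; exact ha),
    hm2, modelRadius_zero, sub_zero, sub_zero] at h
  rw [← h, height, factor]
  simp only [conformalFactor]
  ring

/-- For o on the normal geodesic through p, cosh of the distance to o is affine in the height with
positive slope when 0 ≤ λ ≤ 1. The ball condition thus becomes a bound on the height. -/
theorem neg_mink_stereo {o : HypSpace d}
    (ho : o.vec = Real.cosh s • p.vec + Real.sinh s • n) {a : EuclideanSpace ℝ (Fin (d - 1))}
    (ha : a ∈ stereoDomain d lam) :
    -mink (F.stereo lam a).vec o.vec =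
      Real.cosh s + (Real.cosh s - lam * Real.sinh s) * height lam a := by
  rw [F.stereo_vec ha, ho, mink_add_right, mink_smul_right, mink_smul_right,
    F.mink_stereoVec_base, F.mink_stereoVec_normal]
  ring

theorem mem_closedBall_stereo_iff {o : HypSpace d}
    (ho : o.vec = Real.cosh s • p.vec + Real.sinh s • n) {a : EuclideanSpace ℝ (Fin (d - 1))}
    (ha : a ∈ stereoDomain d lam) {R : ℝ} (hR : 0 ≤ R) :
    F.stereo lam a ∈ Metric.closedBall o R ↔
      Real.cosh s + (Real.cosh s - lam * Real.sinh s) * height lam a ≤ Real.cosh R := by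
  rw [← F.neg_mink_stereo ho ha, ← HypSpace.cosh_dist, Real.cosh_le_cosh,
    abs_of_nonneg dist_nonneg, abs_of_nonneg hR, Metric.mem_closedBall]

theorem base_mem (F : TangentFrame p n) : p ∈ umbilicLevel (n + lam • p.vec) lam := by
  have h := F.stereo_mem (lam := lam) zero_mem_stereoDomain
  rwa [F.stereo_zero] at h

theorem inter_closedBall_nonempty_iff (F : TangentFrame p n) (h0 : 0 ≤ lam) (h1 : lam ≤ 1) {o : HypSpace d}
    (ho : o.vec = Real.cosh s • p.vec + Real.sinh s • n) {R : ℝ} (hR : 0 ≤ R) :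
    (umbilicLevel (n + lam • p.vec) lam ∩ Metric.closedBall o R).Nonempty ↔ |s| ≤ R := by
  have hlam : lam ^ 2 ≤ 1 := by nlinarith
  have hD := cosh_sub_mul_sinh_pos h0 h1 s
  rw [← abs_of_nonneg hR, ← Real.cosh_le_cosh]
  constructor
  · rintro ⟨x, hx, hxo⟩
    have hx' := F.chart_mem_and_stereoVec_chart hlam hx
    rw [← F.stereo_chart hlam hx, F.mem_closedBall_stereo_iff ho hx'.1 (abs_nonneg R)] at hxo
    rw [Real.cosh_abs] at hxo
    nlinarith [mul_nonneg hD.le (height_nonneg hx'.1)]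
  · intro h
    refine ⟨F.stereo lam 0, F.stereo_mem zero_mem_stereoDomain, ?_⟩
    rw [F.mem_closedBall_stereo_iff ho zero_mem_stereoDomain (abs_nonneg R), height,
      Real.cosh_abs]
    simpa using h

/-- The distance is the least radius of a ball that meets the set, so this is the non-emptiness
criterion read for all radii. -/
theorem infDist_umbilicLevel (F : TangentFrame p n) (h0 : 0 ≤ lam) (h1 : lam ≤ 1) {o : HypSpace d}
    (ho : o.vec = Real.cosh s • p.vec + Real.sinh s • n) :
    Metric.infDist o (umbilicLevel (n + lam • p.vec) lam) = |s| := by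
  apply le_antisymm
  · obtain ⟨x, hx, hxo⟩ := (F.inter_closedBall_nonempty_iff h0 h1 ho (abs_nonneg s)).2 le_rfl
    exact (Metric.infDist_le_dist_of_mem hx).trans (Metric.mem_closedBall'.1 hxo)
  · refine (Metric.le_infDist ⟨p, F.base_mem⟩).2 fun {x} hx => ?_
    exact (F.inter_closedBall_nonempty_iff h0 h1 ho dist_nonneg).1
      ⟨x, hx, Metric.mem_closedBall'.2 le_rfl⟩

theorem modelRadius_closedBall_subset (hlam : lam ^ 2 ≤ 1) (t : ℝ) :
    Metric.closedBall 0 (modelRadius √(1 - lam ^ 2) t) ⊆ stereoDomain d lam := fun a ha => by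
  have h := sq_mul_sq_modelRadius_lt √(1 - lam ^ 2) t
  rw [Real.sq_sqrt (by linarith)] at h
  have h2 : ‖a‖ ^ 2 ≤ modelRadius √(1 - lam ^ 2) t ^ 2 :=
    pow_le_pow_left₀ (norm_nonneg a) (by simpa using ha) 2
  have h3 : (1 - lam ^ 2) * ‖a‖ ^ 2 ≤ (1 - lam ^ 2) * modelRadius √(1 - lam ^ 2) t ^ 2 :=
    mul_le_mul_of_nonneg_left h2 (by linarith)
  exact lt_of_le_of_lt h3 h

/-- The condition `htR` says that points at intrinsic distance t from p lie on the sphere of radius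
R about o, since twice the height is the squared chord. Monotonicity of chord and radius then turns
the height bound into a bound on |a|. -/
theorem inter_closedBall_eq (h0 : 0 ≤ lam) (h1 : lam ≤ 1) {o : HypSpace d}
    (ho : o.vec = Real.cosh s • p.vec + Real.sinh s • n) {R : ℝ} (hR : 0 ≤ R) {t : ℝ} (ht : 0 ≤ t)
    (htR : (Real.cosh s - lam * Real.sinh s) * chordLength √(1 - lam ^ 2) t ^ 2 =
      2 * (Real.cosh R - Real.cosh s)) :
    umbilicLevel (n + lam • p.vec) lam ∩ Metric.closedBall o R =
      F.stereo lam '' Metric.closedBall 0 (modelRadius √(1 - lam ^ 2) t) := by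
  have hlam : lam ^ 2 ≤ 1 := by nlinarith
  have hD := cosh_sub_mul_sinh_pos h0 h1 s
  have hm2 : √(1 - lam ^ 2) ^ 2 = 1 - lam ^ 2 := Real.sq_sqrt (by linarith)
  have key : ∀ a ∈ stereoDomain d lam, F.stereo lam a ∈ Metric.closedBall o R ↔
      a ∈ Metric.closedBall 0 (modelRadius √(1 - lam ^ 2) t) := fun a ha => by
    set m := √(1 - lam ^ 2) with hm
    have hm0 : 0 ≤ m := Real.sqrt_nonneg _
    have hr := intrinsicRadius_nonneg hm0 (norm_nonneg a)
    have e1 : ‖a‖ = modelRadius m (intrinsicRadius m ‖a‖) :=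
      (modelRadius_intrinsicRadius hm0 (norm_nonneg a) (by rw [hm2]; exact ha)).symm
    rw [F.mem_closedBall_stereo_iff ho ha hR, mem_closedBall_zero_iff, e1,
      modelRadius_le_modelRadius hm0, ← chordLength_le_chordLength (t := intrinsicRadius m ‖a‖) (t' := t) hm0,
      ← sq_le_sq₀ (chordLength_nonneg hm0 hr) (chordLength_nonneg hm0 ht),
      ← two_mul_height hlam ha,
      ← mul_le_mul_iff_right₀ (b := 2 * height lam a) (c := chordLength m t ^ 2) hD, htR]
    constructor <;> intro h <;> linarith
  ext x
  constructor
  · rintro ⟨hx, hxo⟩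
    have hx' := F.chart_mem_and_stereoVec_chart hlam hx
    refine ⟨F.chart lam x.vec, (key _ hx'.1).1 ?_, F.stereo_chart hlam hx⟩
    rwa [F.stereo_chart hlam hx]
  · rintro ⟨a, ha, rfl⟩
    have ha' := modelRadius_closedBall_subset hlam t ha
    exact ⟨F.stereo_mem ha', (key a ha').2 ha⟩

theorem isIntrinsicBall_stereo_image (hlam : lam ^ 2 ≤ 1) {t : ℝ} (ht : 0 ≤ t) :
    IsIntrinsicBall (umbilicLevel (n + lam • p.vec) lam)
      (F.stereo lam '' Metric.closedBall 0 (modelRadius √(1 - lam ^ 2) t)) := by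
  have hm2 : √(1 - lam ^ 2) ^ 2 = 1 - lam ^ 2 := Real.sq_sqrt (by linarith)
  have key : ∀ a ∈ stereoDomain d lam, intrinsicRadius √(1 - lam ^ 2) ‖a‖ ≤ t ↔
      a ∈ Metric.closedBall 0 (modelRadius √(1 - lam ^ 2) t) := fun a ha => by
    rw [mem_closedBall_zero_iff, ← modelRadius_le_modelRadius (Real.sqrt_nonneg (1 - lam ^ 2)),
      modelRadius_intrinsicRadius (Real.sqrt_nonneg _) (norm_nonneg a) (by rw [hm2]; exact ha)]
  refine ⟨⟨p, F.base_mem⟩, t, ht, ?_⟩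
  ext x
  constructor
  · rintro ⟨a, ha, rfl⟩
    have ha' := modelRadius_closedBall_subset hlam t ha
    refine ⟨⟨_, F.stereo_mem ha'⟩, ?_, rfl⟩
    rw [mem_ofPred_eq, F.lengthEDist_stereo hlam rfl rfl ha' rfl]
    exact ENNReal.ofReal_le_ofReal ((key a ha').2 ha)
  · rintro ⟨⟨x, hxL⟩, hx, rfl⟩
    have ha := F.chart_mem_and_stereoVec_chart hlam hxL
    rw [mem_ofPred_eq, F.lengthEDist_stereo hlam rfl rfl ha.1 (F.stereo_chart hlam hxL).symm,
      ENNReal.ofReal_le_ofReal_iff ht] at hx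
    exact ⟨_, (key _ ha.1).1 hx, F.stereo_chart hlam hxL⟩

end TangentFrame

/-- The foot of the perpendicular from a point to an umbilic level set. -/
theorem exists_foot {w : Mink d} {lam s : ℝ} (h0 : 0 ≤ lam) (h1 : lam ≤ 1)
    (hw : mink w w = 1 - lam ^ 2) {o : HypSpace d}
    (ho : mink o.vec w = Real.sinh s - lam * Real.cosh s) :
    ∃ (p : HypSpace d) (n : Mink d), w = n + lam • p.vec ∧ mink n n = 1 ∧ mink n p.vec = 0 ∧
      o.vec = Real.cosh s • p.vec + Real.sinh s • n := by
  have hD := cosh_sub_mul_sinh_pos h0 h1 s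
  set D := Real.cosh s - lam * Real.sinh s with hDdef
  have hcs := Real.cosh_sq s
  have hwo : mink w o.vec = Real.sinh s - lam * Real.cosh s := by rw [mink_comm, ho]
  -- Solution of o = cosh s · p + sinh s · (w - λp) for p.
  obtain ⟨p, hp⟩ := exists_hypSpace_vec_eq (x := D⁻¹ • (o.vec - Real.sinh s • w)) (p := o)
    (by
      simp only [mink_smul_left, mink_smul_right, mink_sub_left, mink_sub_right, o.mink_self, ho,
        hwo, hw]
      field_simp
      rw [hDdef]
      linear_combination hcs)
    (by
      simp only [mink_smul_left, mink_sub_left, o.mink_self, hwo]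
      have : -1 - Real.sinh s * (Real.sinh s - lam * Real.cosh s) = -(Real.cosh s * D) := by
        rw [hDdef]
        linear_combination hcs
      rw [this]
      have hc := Real.cosh_pos s
      field_simp
      linarith)
  have hwp : mink w p.vec = -lam := by
    simp only [hp, mink_smul_right, mink_sub_right, hwo, hw]
    field_simp
    rw [hDdef]
    ring
  have hpw : mink p.vec w = -lam := by rw [mink_comm, hwp]
  refine ⟨p, w - lam • p.vec, by abel, ?_, ?_, ?_⟩
  · simp only [mink_smul_left, mink_smul_right, mink_sub_left, mink_sub_right, hw, hwp, hpw,
      p.mink_self]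
    ring
  · simp only [mink_smul_left, mink_sub_left, hwp, p.mink_self]
    ring
  · have h2 : D • p.vec = o.vec - Real.sinh s • w := by
      rw [hp, smul_smul, mul_inv_cancel₀ hD.ne', one_smul]
    have h3 : o.vec = D • p.vec + Real.sinh s • w := by rw [h2]; abel
    rw [h3, hDdef]
    module

/-- The intersection of an umbilic level set with a ball centered at signed distance `s`. -/
theorem umbilicLevel_inter_closedBall (hd : 2 ≤ d) {w : Mink d} {lam s R : ℝ} (h0 : 0 ≤ lam)
    (h1 : lam ≤ 1) (hw : mink w w = 1 - lam ^ 2) {o : HypSpace d}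
    (ho : mink o.vec w = Real.sinh s - lam * Real.cosh s) (hR : 0 < R) :
    ((umbilicLevel w lam ∩ Metric.closedBall o R).Nonempty ↔ |s| ≤ R) ∧
    (|s| ≤ R → IsIntrinsicBall (umbilicLevel w lam) (umbilicLevel w lam ∩ Metric.closedBall o R)) ∧
    (|s| ≤ R → lam = 1 →
      Measure.euclideanHausdorffMeasure (d - 1) (umbilicLevel w lam ∩ Metric.closedBall o R) =
        ENNReal.ofReal (ballVolume (d - 1) *
          (2 * Real.exp s * (Real.cosh R - Real.cosh s)) ^ (((d : ℝ) - 1) / 2))) ∧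
    (|s| ≤ R → lam < 1 →
      Measure.euclideanHausdorffMeasure (d - 1) (umbilicLevel w lam ∩ Metric.closedBall o R) =
        ENNReal.ofReal (ballSurface (d - 1) / √(1 - lam ^ 2) ^ (d - 1) *
          ∫ u in (0 : ℝ)..rho lam s R, Real.sinh u ^ (d - 2))) := by
  obtain ⟨p, n, rfl, hn, hnp, hop⟩ := exists_foot h0 h1 hw ho
  obtain ⟨F⟩ := exists_tangentFrame hd p hn hnp
  have hlam : lam ^ 2 ≤ 1 := by nlinarith
  have hD := cosh_sub_mul_sinh_pos h0 h1 s
  have hcosh : |s| ≤ R → 0 ≤ Real.cosh R - Real.cosh s := fun h => by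
    rw [← abs_of_pos hR, ← Real.cosh_le_cosh] at h
    linarith
  -- Horospheres are flat: the chord is t itself and cosh s - sinh s = exp (-s), so the radius
  -- satisfies t² = 2 exp s (cosh R - cosh s).
  have hone : |s| ≤ R → lam = 1 → 0 ≤ 2 * Real.exp s * (Real.cosh R - Real.cosh s) ∧
      (Real.cosh s - lam * Real.sinh s) * chordLength √(1 - lam ^ 2)
        √(2 * Real.exp s * (Real.cosh R - Real.cosh s)) ^ 2 =
      2 * (Real.cosh R - Real.cosh s) := by
    rintro hs rfl
    have hnn : 0 ≤ 2 * Real.exp s * (Real.cosh R - Real.cosh s) :=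
      mul_nonneg (by positivity) (hcosh hs)
    refine ⟨hnn, ?_⟩
    rw [show √(1 - (1 : ℝ) ^ 2) = 0 by simp, chordLength, if_pos rfl, Real.sq_sqrt hnn, one_mul,
      Real.cosh_sub_sinh]
    have : Real.exp (-s) * Real.exp s = 1 := by rw [← Real.exp_add]; simp
    linear_combination 2 * (Real.cosh R - Real.cosh s) * this
  -- In curvature -m² the radius is t = ρ / m, because m² times the squared chord is 2 (cosh (m t) -
  -- 1). The argument of arcosh in ρ simplifies through cosh Δ = 1 / m and sinh Δ = λ / m.
  have hlt : |s| ≤ R → lam < 1 → 0 ≤ rho lam s R ∧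
      (Real.cosh s - lam * Real.sinh s) * chordLength √(1 - lam ^ 2)
        (rho lam s R / √(1 - lam ^ 2)) ^ 2 = 2 * (Real.cosh R - Real.cosh s) := by
    intro hs hl
    have hpos : 0 < 1 - lam ^ 2 := by nlinarith
    set m := √(1 - lam ^ 2) with hm
    have hm0 : 0 < m := Real.sqrt_pos.2 hpos
    have hm2 : m ^ 2 = 1 - lam ^ 2 := Real.sq_sqrt hpos.le
    have hl1 : lam ∈ Ioo (-1 : ℝ) 1 := ⟨by linarith, hl⟩
    have harg : (Real.cosh R - Real.sinh (Real.artanh lam) * Real.sinh (s - Real.artanh lam)) /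
        (Real.cosh (Real.artanh lam) * Real.cosh (s - Real.artanh lam)) =
        1 + m ^ 2 * ((Real.cosh R - Real.cosh s) / (Real.cosh s - lam * Real.sinh s)) := by
      rw [Real.sinh_sub, Real.cosh_sub, Real.sinh_artanh hl1, Real.cosh_artanh hl1, ← hm]
      have h3 : Real.cosh s * (1 / m) - Real.sinh s * (lam / m) ≠ 0 := by
        have : Real.cosh s * (1 / m) - Real.sinh s * (lam / m) =
          (Real.cosh s - lam * Real.sinh s) / m := by ring
        rw [this]
        positivity
      field_simp
      linear_combination Real.cosh s * hm2
    have h1le : 1 ≤ (Real.cosh R - Real.sinh (Real.artanh lam) * Real.sinh (s - Real.artanh lam)) /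
        (Real.cosh (Real.artanh lam) * Real.cosh (s - Real.artanh lam)) := by
      rw [harg]
      have := hcosh hs
      have : 0 ≤ m ^ 2 * ((Real.cosh R - Real.cosh s) / (Real.cosh s - lam * Real.sinh s)) := by
        positivity
      linarith
    refine ⟨Real.arcosh_nonneg h1le, ?_⟩
    have h4 := sq_chordLength hm0 (rho lam s R / m)
    have hrho : Real.cosh (rho lam s R) =
        1 + m ^ 2 * ((Real.cosh R - Real.cosh s) / (Real.cosh s - lam * Real.sinh s)) := by
      rw [rho, Real.cosh_arcosh h1le, harg]
    rw [mul_div_cancel₀ _ hm0.ne', hrho] at h4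
    have h5 : chordLength m (rho lam s R / m) ^ 2 =
        2 * ((Real.cosh R - Real.cosh s) / (Real.cosh s - lam * Real.sinh s)) := by
      refine mul_left_cancel₀ (pow_pos hm0 2).ne' ?_
      rw [h4]
      ring
    rw [h5]
    field_simp
  refine ⟨F.inter_closedBall_nonempty_iff h0 h1 hop hR.le, fun hs => ?_, fun hs hl => ?_,
    fun hs hl => ?_⟩
  · rcases h1.eq_or_lt with hl | hl
    · rw [F.inter_closedBall_eq h0 h1 hop hR.le (Real.sqrt_nonneg _) (hone hs hl).2]
      exact F.isIntrinsicBall_stereo_image hlam (Real.sqrt_nonneg _)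
    · have ht : 0 ≤ rho lam s R / √(1 - lam ^ 2) :=
        div_nonneg (hlt hs hl).1 (Real.sqrt_nonneg _)
      rw [F.inter_closedBall_eq h0 h1 hop hR.le ht (hlt hs hl).2]
      exact F.isIntrinsicBall_stereo_image hlam ht
  · rw [F.inter_closedBall_eq h0 h1 hop hR.le (Real.sqrt_nonneg _) (hone hs hl).2,
      F.euclideanHausdorffMeasure_stereo_image measurableSet_closedBall
        (TangentFrame.modelRadius_closedBall_subset hlam _)]
    subst hl
    have hnn := (hone hs rfl).1
    simp only [TangentFrame.factor]
    rw [show √(1 - (1 : ℝ) ^ 2) = 0 by simp, show (1 - (1 : ℝ) ^ 2) = 0 by simp, modelRadius,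
      if_pos rfl, lintegral_conformalFactor_zero _ (Real.sqrt_nonneg _), Real.sqrt_eq_rpow,
      ← Real.rpow_natCast, ← Real.rpow_mul hnn]
    congr 3
    rw [Nat.cast_sub (by omega)]
    push_cast
    ring
  · have ht : 0 ≤ rho lam s R / √(1 - lam ^ 2) :=
      div_nonneg (hlt hs hl).1 (Real.sqrt_nonneg _)
    have hm0 : 0 < √(1 - lam ^ 2) := Real.sqrt_pos.2 (by nlinarith)
    rw [F.inter_closedBall_eq h0 h1 hop hR.le ht (hlt hs hl).2,
      F.euclideanHausdorffMeasure_stereo_image measurableSet_closedBall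
        (TangentFrame.modelRadius_closedBall_subset hlam _)]
    -- Now d - 1 = k + 1 and d - 2 = k, so the truncated subtractions match the volume formula in
    -- dimension k + 1.
    obtain ⟨k, rfl⟩ : ∃ k, d = k + 2 := ⟨d - 2, by omega⟩
    have := lintegral_conformalFactor hm0 k ht
    rw [Real.sq_sqrt (by linarith), mul_div_cancel₀ _ hm0.ne'] at this
    exact this

/-! ### Classification of umbilic hypersurfaces -/

theorem fderiv_mink {E : Type*} [NormedAddCommGroup E] [NormedSpace ℝ E] {f g : E → Mink d} {x : E}
    (hf : DifferentiableAt ℝ f x) (hg : DifferentiableAt ℝ g x) (v : E) :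
    fderiv ℝ (fun y => mink (f y) (g y)) x v =
      mink (fderiv ℝ f x v) (g x) + mink (f x) (fderiv ℝ g x v) := by
  have h := (hf.hasFDerivAt.snd.inner ℝ hg.hasFDerivAt.snd).sub
    (hf.hasFDerivAt.fst.mul hg.hasFDerivAt.fst)
  have h' : HasFDerivAt (fun y => mink (f y) (g y)) _ x := h
  rw [h'.fderiv]
  simp [mink, fderivInnerCLM_apply]
  ring

theorem fderiv_mink_of_eventually_const {E : Type*} [NormedAddCommGroup E] [NormedSpace ℝ E]
    {f g : E → Mink d} {x : E} (hf : DifferentiableAt ℝ f x) (hg : DifferentiableAt ℝ g x) {c : ℝ}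
    (h : ∀ᶠ y in 𝓝 x, mink (f y) (g y) = c) (v : E) :
    mink (fderiv ℝ f x v) (g x) + mink (f x) (fderiv ℝ g x v) = 0 := by
  have h' : (fun y => mink (f y) (g y)) =ᶠ[𝓝 x] fun _ => c := h
  rw [← fderiv_mink hf hg, h'.fderiv_eq]
  simp

variable {H : Set (HypSpace d)} {lam : ℝ} {n : H → Mink d}

/-- The shape operator of a totally umbilic hypersurface is scalar. -/
theorem fderiv_normal_add_smul_eq_zero (hd : 2 ≤ d) (hn : IsUnitNormalField n)
    (hu : IsTotallyUmbilicWith n lam)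
    {e : OpenPartialHomeomorph (EuclideanSpace ℝ (Fin (d - 1))) H} (he : IsSmoothParam e)
    {u : EuclideanSpace ℝ (Fin (d - 1))} (hus : u ∈ e.source)
    (v : EuclideanSpace ℝ (Fin (d - 1))) :
    fderiv ℝ (n ∘ e) u v + lam • fderiv ℝ (paramVec e) u v = 0 := by
  have hnhds : e.source ∈ 𝓝 u := e.open_source.mem_nhds hus
  have hP : ContDiffAt ℝ ∞ (paramVec e) u := he.1.contDiffAt hnhds
  have hN : ContDiffAt ℝ ∞ (n ∘ e) u := (hn.2 e he).1.contDiffAt hnhds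
  have hPd := hP.differentiableAt (by simp)
  have hNd := hN.differentiableAt (by simp)
  have hDd : ∀ w, DifferentiableAt ℝ (fun u' => fderiv ℝ (paramVec e) u' w) u := fun w =>
    ((hP.fderiv_right (m := 1) (by norm_cast)).differentiableAt (by simp)).clm_apply
      (differentiableAt_const w)
  have hPP : ∀ v, mink (fderiv ℝ (paramVec e) u v) (paramVec e u) = 0 := fun v => by
    have := fderiv_mink_of_eventually_const hPd hPd
      (Eventually.of_forall fun u' => (e u' : HypSpace d).mink_self) v
    rw [mink_comm (paramVec e u)] at this
    linarith
  have hPN : ∀ v, mink (fderiv ℝ (paramVec e) u v) (n (e u)) = 0 := (hn.2 e he).2 u hus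
  have hNP : mink (fderiv ℝ (n ∘ e) u v) (paramVec e u) = 0 := by
    have := fderiv_mink_of_eventually_const hNd hPd
      (Eventually.of_forall fun u' => (hn.1 (e u')).2) v
    rw [mink_comm ((n ∘ e) u)] at this
    change mink _ _ + mink _ (n (e u)) = 0 at this
    rwa [hPN v, add_zero] at this
  have hNN : mink (fderiv ℝ (n ∘ e) u v) (n (e u)) = 0 := by
    have := fderiv_mink_of_eventually_const hNd hNd
      (Eventually.of_forall fun u' => (hn.1 (e u')).1) v
    rw [mink_comm ((n ∘ e) u)] at this
    change mink (fderiv ℝ (n ∘ e) u v) (n (e u)) + mink (fderiv ℝ (n ∘ e) u v) (n (e u)) = 0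
      at this
    linarith
  set y := fderiv ℝ (n ∘ e) u v + lam • fderiv ℝ (paramVec e) u v with hy
  -- Differentiate ⟨∂_w e, n⟩ = 0 in direction v and insert umbilicity. The tangential projection in
  -- the covariant derivative has no effect, since n is orthogonal to the position vector.
  have hyw : ∀ w, mink (fderiv ℝ (paramVec e) u w) y = 0 := fun w => by
    have h1 := fderiv_mink_of_eventually_const (hDd w) hNd
      (by filter_upwards [hnhds] with u' hu' using (hn.2 e he).2 u' hu' w) v
    have h2 := hu e he u hus v w
    rw [covDeriv, tangentProj, mink_add_left, mink_smul_left, mink_comm (e u : HypSpace d).vec,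
      (hn.1 (e u)).2, mul_zero, add_zero] at h2
    change mink _ (n (e u)) + _ = 0 at h1
    rw [hy, mink_add_right, mink_smul_right, mink_comm (fderiv ℝ (paramVec e) u w)
      (fderiv ℝ (paramVec e) u v)]
    linarith
  have hyp : mink y (e u : HypSpace d).vec = 0 := by
    rw [hy, mink_add_left, mink_smul_left]
    change mink _ (paramVec e u) + lam * mink _ (paramVec e u) = 0
    rw [hNP, hPP]
    ring
  have hyn : mink y (n (e u)) = 0 := by
    rw [hy, mink_add_left, mink_smul_left, hNN, hPN]
    ring
  -- By dimension the differential of e maps onto the complement of the position vector and n, so y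
  -- is itself of the form ∂_w e. It is then orthogonal to itself in a positive definite space.
  obtain ⟨F⟩ := exists_tangentFrame hd (e u : HypSpace d) (hn.1 (e u)).1 (hn.1 (e u)).2
  let A := (F.proj.comp (fderiv ℝ (paramVec e) u)).toLinearMap
  have hA : ∀ w, F.incl (A w) = fderiv ℝ (paramVec e) u w := fun w =>
    F.incl_proj (hPP w) (hPN w)
  have hAinj : Function.Injective A := fun w w' hww => by
    refine he.2 u hus ?_
    rw [← hA, ← hA, hww]
  obtain ⟨w, hw⟩ := LinearMap.injective_iff_surjective.1 hAinj (F.proj y)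
  have hwy : fderiv ℝ (paramVec e) u w = y := by
    rw [← hA, hw, F.incl_proj hyp hyn]
  refine HypSpace.eq_zero_of_mink_self_nonpos (e u : HypSpace d) hyp ?_
  have := hyw w
  rw [hwy] at this
  exact this.le

theorem normal_add_smul_const (hd : 2 ≤ d) (hconn : IsConnected H) (hH : IsHypersurface H)
    (hn : IsUnitNormalField n) (hu : IsTotallyUmbilicWith n lam) (x y : H) :
    n x + lam • (x : HypSpace d).vec = n y + lam • (y : HypSpace d).vec := by
  have hloc : IsLocallyConstant fun x : H => n x + lam • (x : HypSpace d).vec := by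
    refine IsLocallyConstant.iff_exists_open _ |>.2 fun x => ?_
    obtain ⟨e, he, hx⟩ := hH x
    obtain ⟨ε, hε, hball⟩ := Metric.isOpen_iff.1 e.open_source _ (e.map_target hx)
    refine ⟨e '' Metric.ball (e.symm x) ε,
      e.isOpen_image_of_subset_source Metric.isOpen_ball hball,
      ⟨e.symm x, Metric.mem_ball_self hε, e.right_inv hx⟩, ?_⟩
    rintro _ ⟨u, hu', rfl⟩
    set g : EuclideanSpace ℝ (Fin (d - 1)) → Mink d := fun u => (n ∘ e) u + lam • paramVec e u
      with hg
    have hdiff : ∀ u ∈ Metric.ball (e.symm x) ε, DifferentiableAt ℝ (n ∘ e) u ∧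
        DifferentiableAt ℝ (paramVec e) u := fun u hu' =>
      ⟨((hn.2 e he).1.contDiffAt (e.open_source.mem_nhds (hball hu'))).differentiableAt (by simp),
        (he.1.contDiffAt (e.open_source.mem_nhds (hball hu'))).differentiableAt (by simp)⟩
    have key : g u = g (e.symm x) := by
      refine Metric.isOpen_ball.is_const_of_fderiv_eq_zero (𝕜 := ℝ)
        (convex_ball _ _).isPreconnected (fun u hu' => ?_) (fun u hu' => ?_) hu'
        (Metric.mem_ball_self hε)
      · exact ((hdiff u hu').1.add ((hdiff u hu').2.const_smul lam)).differentiableWithinAt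
      · refine ContinuousLinearMap.ext fun v => ?_
        have h1 : HasFDerivAt g _ u := (hdiff u hu').1.hasFDerivAt.add
          ((hdiff u hu').2.hasFDerivAt.const_smul lam)
        rw [h1.fderiv]
        exact fderiv_normal_add_smul_eq_zero hd hn hu he (hball hu') v
    simp only [hg, Function.comp, paramVec, e.right_inv hx] at key
    exact key
  have : PreconnectedSpace H := Subtype.preconnectedSpace hconn.isPreconnected
  exact hloc.apply_eq_of_preconnectedSpace x y

theorem lengthEDist_comm {X : Type*} [PseudoEMetricSpace X] (x y : X) :
    lengthEDist x y = lengthEDist y x := by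
  have key : ∀ x y : X, lengthEDist x y ≤ lengthEDist y x := fun x y => by
    refine le_iInf fun γ => (iInf_le _ γ.symm).trans ?_
    exact eVariationOn.comp_le_of_antitoneOn γ unitInterval.symm
      (fun s _ t _ hst => unitInterval.symm_le_symm.2 hst) (mapsTo_univ _ _)
  exact le_antisymm (key x y) (key y x)

/-- A complete set contains the end points of the curves of unit speed running inside it. -/
theorem mem_of_forall_lt_mem {X : Type*} [MetricSpace X] {H : Set X}
    (hcomp : IntrinsicallyComplete H) {γ : ℝ → X} (hγ : ∀ s t, dist (γ s) (γ t) ≤ |s - t|) {t : ℝ}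
    (ht : 0 < t) (hmem : ∀ t' ∈ Ico 0 t, γ t' ∈ H) : γ t ∈ H := by
  -- Times in [0, t) tending to t. The curve between two of them stays in H, so its points form an
  -- intrinsic Cauchy sequence.
  set q : ℕ → ℝ := fun k => t - t / (k + 1) with hq
  have hqmem : ∀ k, q k ∈ Ico 0 t := fun k => by
    have h1 : 0 < t / ((k : ℝ) + 1) := by positivity
    have h2 : t / ((k : ℝ) + 1) ≤ t := div_le_self ht.le (by linarith [k.cast_nonneg (α := ℝ)])
    constructor <;> simp only [hq] <;> linarith
  let u : ℕ → H := fun k => ⟨γ (q k), hmem _ (hqmem k)⟩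
  have hle : ∀ k l, q k ≤ q l → lengthEDist (u k) (u l) ≤ ENNReal.ofReal (q l - q k) :=
    fun k l hkl => lengthEDist_le_of_lipschitz hkl (fun s _ t _ => hγ s t) fun t' ht' =>
      hmem t' ⟨(hqmem k).1.trans ht'.1, ht'.2.trans_lt (hqmem l).2⟩
  have hlim : Tendsto (fun k : ℕ => t / ((k : ℝ) + 1)) atTop (𝓝 0) := by
    have := (tendsto_one_div_add_atTop_nhds_zero_nat (𝕜 := ℝ)).const_mul t
    simpa [div_eq_mul_inv] using this
  have hbound : ∀ N k l, N ≤ k → N ≤ l →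
      lengthEDist (u k) (u l) ≤ ENNReal.ofReal (t / ((N : ℝ) + 1)) := by
    intro N k l hk hl
    have hmono : ∀ j, N ≤ j → t - t / ((N : ℝ) + 1) ≤ q j := fun j hj => by
      have : (N : ℝ) ≤ j := by exact_mod_cast hj
      simp only [hq]
      gcongr
    rcases le_total (q k) (q l) with h | h
    · refine (hle k l h).trans (ENNReal.ofReal_le_ofReal ?_)
      linarith [hmono k hk, (hqmem l).2]
    · rw [lengthEDist_comm]
      refine (hle l k h).trans (ENNReal.ofReal_le_ofReal ?_)
      linarith [hmono l hl, (hqmem k).2]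
  obtain ⟨x, hx⟩ := hcomp u fun ε hε => by
    have h0 : Tendsto (fun k : ℕ => ENNReal.ofReal (t / ((k : ℝ) + 1))) atTop (𝓝 0) := by
      simpa using ENNReal.tendsto_ofReal hlim
    obtain ⟨N, hN⟩ := (h0.eventually_lt_const hε).exists
    exact ⟨N, fun k hk l hl => (hbound N k l hk hl).trans_lt hN⟩
  have h1 : Tendsto (fun k => γ (q k)) atTop (𝓝 (x : X)) := by
    rw [tendsto_iff_edist_tendsto_0]
    exact tendsto_of_tendsto_of_tendsto_of_le_of_le tendsto_const_nhds hx (fun _ => zero_le)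
      fun k => edist_le_lengthEDist (u k) x
  have h2 : Tendsto (fun k => γ (q k)) atTop (𝓝 (γ t)) := by
    rw [tendsto_iff_dist_tendsto_zero]
    refine squeeze_zero (fun _ => dist_nonneg) (fun k => hγ _ _) ?_
    refine hlim.congr fun k => ?_
    have : 0 ≤ t / ((k : ℝ) + 1) := by positivity
    simp only [hq, sub_sub_cancel_left, abs_neg, abs_of_nonneg this]
  rw [tendsto_nhds_unique h2 h1]
  exact x.2

namespace TangentFrame

variable {p : HypSpace d} {n₀ : Mink d} (F : TangentFrame p n₀)

/-- A parametrization read in the chart has injective differential, as composing with the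
stereographic map gives the parametrization back. Source and target have dimension d - 1, so it is a
local surjection, and H is open in the level set. -/
theorem image_chart_mem_nhds (hlam : lam ^ 2 ≤ 1) (hH : IsHypersurface H)
    (hsub : H ⊆ umbilicLevel (n₀ + lam • p.vec) lam) {x : HypSpace d} (hx : x ∈ H) :
    (fun y : HypSpace d => F.chart lam y.vec) '' H ∈ 𝓝 (F.chart lam x.vec) := by
  obtain ⟨e, he, hxe⟩ := hH ⟨x, hx⟩
  set u := e.symm ⟨x, hx⟩ with hu
  have hus : u ∈ e.source := e.map_target hxe
  have hnhds : e.source ∈ 𝓝 u := e.open_source.mem_nhds hus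
  have heu : (e u : HypSpace d) = x := by rw [hu, e.right_inv hxe]
  have hP : ContDiffAt ℝ ∞ (paramVec e) u := he.1.contDiffAt hnhds
  set ψ := F.chart lam ∘ paramVec e with hψ
  have hψc : ContDiffAt ℝ ∞ ψ u := (F.contDiffAt_chart hlam (e u : HypSpace d)).comp u hP
  have hmem : ∀ u' : EuclideanSpace ℝ (Fin (d - 1)), (e u' : HypSpace d) ∈
    umbilicLevel (n₀ + lam • p.vec) lam := fun u' => hsub (e u').2
  have hsψ : F.stereoVec lam ∘ ψ = paramVec e := funext fun u' =>
    (F.chart_mem_and_stereoVec_chart hlam (hmem u')).2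
  have hψD : ψ u ∈ stereoDomain d lam := (F.chart_mem_and_stereoVec_chart hlam (hmem u)).1
  have hstrict := hψc.hasStrictFDerivAt (by simp)
  have hinj : Function.Injective (fderiv ℝ ψ u) := fun v v' hv => by
    refine he.2 u hus ?_
    have h1 := (F.contDiffAt_stereoVec hψD).differentiableAt (by simp)
    rw [← hsψ, fderiv_comp u h1 (hψc.differentiableAt (by simp)),
      ContinuousLinearMap.comp_apply, ContinuousLinearMap.comp_apply, hv]
  have hsurj : (fderiv ℝ ψ u).range = ⊤ := LinearMap.range_eq_top.2
    ((LinearMap.injective_iff_surjective (f := (fderiv ℝ ψ u).toLinearMap)).1 hinj)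
  have hmap := hstrict.map_nhds_eq_of_surj hsurj
  have hψu : ψ u = F.chart lam x.vec := by
    simp only [hψ, Function.comp, paramVec, heu]
  rw [← hψu, ← hmap]
  refine mem_of_superset (image_mem_map hnhds) ?_
  rintro _ ⟨u', -, rfl⟩
  exact ⟨e u', (e u').2, rfl⟩

/-- Every point of the level set is joined to p by a radial curve of speed at most one. The times up
to which the curve stays in H form a closed set by completeness, and one that can be extended to the
right by openness. -/
theorem eq_umbilicLevel (F : TangentFrame p n₀) (hlam : lam ^ 2 ≤ 1) (hH : IsHypersurface H)
    (hcomp : IntrinsicallyComplete H) (hp : p ∈ H)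
    (hsub : H ⊆ umbilicLevel (n₀ + lam • p.vec) lam) :
    H = umbilicLevel (n₀ + lam • p.vec) lam := by
  refine hsub.antisymm fun y hy => ?_
  obtain ⟨haD, -⟩ := F.chart_mem_and_stereoVec_chart hlam hy
  have hya := F.stereo_chart hlam hy
  set a := F.chart lam y.vec with ha
  rcases eq_or_ne a 0 with ha0 | ha0
  · rw [ha0, F.stereo_zero] at hya
    rwa [← hya]
  set m := √(1 - lam ^ 2) with hm
  have hm2 : m ^ 2 = 1 - lam ^ 2 := Real.sq_sqrt (by linarith)
  have hm0 : 0 ≤ m := Real.sqrt_nonneg _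
  set u := ‖a‖⁻¹ • a with hu
  have hu1 : ‖u‖ = 1 := norm_smul_inv_norm ha0
  set r := intrinsicRadius m ‖a‖ with hr
  have hr0 : 0 ≤ r := intrinsicRadius_nonneg hm0 (norm_nonneg a)
  set γ : ℝ → HypSpace d := fun t => F.stereo lam (modelRadius m t • u) with hγ
  have hγ1 : ∀ s t, dist (γ s) (γ t) ≤ |s - t| := F.dist_stereo_radial_le hlam hu1
  have hγ0 : γ 0 = p := by simp [hγ, F.stereo_zero]
  have hγr : γ r = y := by
    have hau : modelRadius m r • u = a := by
      rw [hr, modelRadius_intrinsicRadius hm0 (norm_nonneg a) (by rw [hm2]; exact haD), hu,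
        smul_smul, mul_inv_cancel₀ (norm_ne_zero_iff.2 ha0), one_smul]
    simp only [hγ, hau, hya]
  have hchart : ∀ t, F.chart lam (γ t).vec = modelRadius m t • u := fun t =>
    F.chart_stereo (smul_modelRadius_mem hlam hu1 t)
  have hopen : ∀ t, γ t ∈ H → ∀ᶠ t' in 𝓝 t, γ t' ∈ H := fun t ht => by
    have h1 := F.image_chart_mem_nhds hlam hH hsub ht
    have hc : Continuous fun t => F.chart lam (γ t).vec := by
      simp only [hchart]
      exact (continuous_modelRadius m).smul continuous_const
    filter_upwards [hc.continuousAt.preimage_mem_nhds h1] with t' ⟨z, hz, hzt⟩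
    have hzt : F.chart lam z.vec = F.chart lam (γ t').vec := hzt
    rw [hchart] at hzt
    have : γ t' = z := by
      rw [← F.stereo_chart hlam (hsub hz), hzt]
    rwa [this]
  set S : Set ℝ := {t | ∀ t' ∈ Icc 0 t, γ t' ∈ H} with hS
  have hIcc : Icc 0 r ⊆ S := by
    refine IsClosed.Icc_subset_of_forall_exists_gt ?_ ?_ ?_
    · refine isClosed_of_closure_subset fun t ht => ?_
      have htI : t ∈ Icc 0 r := closure_minimal inter_subset_right isClosed_Icc ht
      refine ⟨?_, htI⟩
      have hlt : ∀ t' ∈ Ico 0 t, γ t' ∈ H := fun t' ht' => by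
        obtain ⟨q, hqt, hq⟩ := mem_closure_iff.1 ht (Ioi t') isOpen_Ioi ht'.2
        exact hq.1 t' ⟨ht'.1, le_of_lt hqt⟩
      intro t' ht'
      rcases ht'.2.lt_or_eq with h | rfl
      · exact hlt t' ⟨ht'.1, h⟩
      · rcases ht'.1.eq_or_lt with h | h
        · rwa [← h, hγ0]
        · exact mem_of_forall_lt_mem hcomp hγ1 h hlt
    · intro t' ht'
      rw [Icc_self, mem_singleton_iff] at ht'
      rwa [ht', hγ0]
    · rintro t ⟨ht, ht0, -⟩ t₁ ht₁
      have h1 := hopen t (ht t ⟨ht0, le_rfl⟩)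
      obtain ⟨ε, hε, hball⟩ := Metric.eventually_nhds_iff.1 h1
      have ht₁ : t < t₁ := ht₁
      refine ⟨min t₁ (t + ε / 2), fun t' ht' => ?_, lt_min ht₁ (by linarith), min_le_left _ _⟩
      rcases le_or_gt t' t with h | h
      · exact ht t' ⟨ht'.1, h⟩
      · refine hball ?_
        rw [Real.dist_eq, abs_of_pos (by linarith)]
        linarith [ht'.2.trans (min_le_right _ _)]
  rw [← hγr]
  exact hIcc ⟨hr0, le_rfl⟩ r ⟨hr0, le_rfl⟩

end TangentFrame

/-- Every `lam`-geodesic hyperplane is a section of the hyperboloid by an affine hyperplane. -/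
theorem IsLambdaGeodesicHyperplane.exists_eq_umbilicLevel (hd : 2 ≤ d) (h0 : 0 ≤ lam)
    (h1 : lam ≤ 1) (hH : IsLambdaGeodesicHyperplane lam H) :
    ∃ (p : HypSpace d) (w : Mink d), p ∈ H ∧ mink w w = 1 - lam ^ 2 ∧
      H = umbilicLevel w lam := by
  obtain ⟨hconn, hhyp, hcomp, n, hn, hu⟩ := hH
  obtain ⟨p, hp⟩ := hconn.nonempty
  obtain ⟨hnn, hnp⟩ := hn.1 ⟨p, hp⟩
  have hmink : ∀ x : H, mink (x : HypSpace d).vec (n x + lam • (x : HypSpace d).vec) = -lam :=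
    fun x => by
      rw [mink_add_right, mink_smul_right, mink_comm _ (n x), (hn.1 x).2,
        (x : HypSpace d).mink_self]
      ring
  obtain ⟨F⟩ := exists_tangentFrame hd p hnn hnp
  refine ⟨p, n ⟨p, hp⟩ + lam • p.vec, hp, ?_, ?_⟩
  · simp only [mink_add_left, mink_add_right, mink_smul_left, mink_smul_right, p.mink_self, hnn]
    rw [mink_comm p.vec, show mink (n ⟨p, hp⟩) p.vec = 0 from hnp]
    ring
  · refine F.eq_umbilicLevel (by nlinarith) hhyp hcomp hp fun x hx => ?_
    have := hmink ⟨x, hx⟩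
    rwa [normal_add_smul_const hd hconn hhyp hn hu ⟨x, hx⟩ ⟨p, hp⟩] at this

/-! ### The sides of an umbilic level set -/

theorem exists_signed_distance {w : Mink d} {lam : ℝ} (h0 : 0 ≤ lam) (h1 : lam ≤ 1)
    (hw : mink w w = 1 - lam ^ 2) {p : HypSpace d} (hp : p ∈ umbilicLevel w lam)
    (o : HypSpace d) : ∃ s, mink o.vec w = Real.sinh s - lam * Real.cosh s := by
  set y := mink o.vec w with hy
  set q := √(y ^ 2 + (1 - lam ^ 2)) with hq
  have hK : 0 ≤ 1 - lam ^ 2 := by nlinarith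
  have hq2 : q ^ 2 = y ^ 2 + (1 - lam ^ 2) := Real.sq_sqrt (by positivity)
  have hq0 : 0 ≤ q := Real.sqrt_nonneg _
  have hyq : 0 < q - y := by
    rcases h1.eq_or_lt with rfl | h1
    · have hwp : mink w p.vec = -1 := by rw [mink_comm]; exact hp
      have hww : mink w w ≤ 0 := by rw [hw]; norm_num
      have := mink_neg_of_time_pos hww (time_pos_of_mink_neg hww (p := p) (by rw [hwp]; norm_num)) o
      rw [mink_comm, ← hy] at this
      linarith
    · have : y ^ 2 < q ^ 2 := by nlinarith
      linarith [(abs_lt_of_sq_lt_sq' this hq0).2]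
  -- The equation is (1 - λ) X² - 2 y X - (1 + λ) = 0 in X = exp s. Its positive root (y + q) / (1 -
  -- λ) is written as (1 + λ) / (q - y), which remains valid for λ = 1.
  have hx : 0 < (1 + lam) / (q - y) := by positivity
  refine ⟨Real.log ((1 + lam) / (q - y)), ?_⟩
  rw [Real.sinh_eq, Real.cosh_eq, Real.exp_neg, Real.exp_log hx, inv_div]
  have hl : (1 + lam) ≠ 0 := by positivity
  field_simp
  linear_combination (1 + lam) * hq2

theorem neg_lt_sinh_sub_iff {lam s : ℝ} (h0 : 0 ≤ lam) (h1 : lam ≤ 1) :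
    (-lam < Real.sinh s - lam * Real.cosh s ↔ 0 < s) ∧
      (Real.sinh s - lam * Real.cosh s < -lam ↔ s < 0) := by
  have hc := Real.one_le_cosh s
  have hpos : 0 < s → -lam < Real.sinh s - lam * Real.cosh s := fun hs => by
    have h2 : Real.exp (-s) < 1 := by
      simpa using Real.exp_lt_exp.2 (show -s < 0 by linarith)
    rw [← Real.cosh_sub_sinh] at h2
    nlinarith
  have hneg : s < 0 → Real.sinh s - lam * Real.cosh s < -lam := fun hs => by
    have h2 := Real.sinh_neg_iff.2 hs
    nlinarith
  have hzero : s = 0 → Real.sinh s - lam * Real.cosh s = -lam := by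
    rintro rfl
    simp
  rcases lt_trichotomy s 0 with h | h | h
  · have := hneg h
    constructor <;> constructor <;> intro <;> linarith
  · have := hzero h
    constructor <;> constructor <;> intro <;> linarith
  · have := hpos h
    constructor <;> constructor <;> intro <;> linarith

/-- Moving a point of an umbilic level set along the normal geodesic. -/
theorem exists_normal_flow {w : Mink d} {lam : ℝ} (hw : mink w w = 1 - lam ^ 2) {x : HypSpace d}
    (hx : x ∈ umbilicLevel w lam) (s : ℝ) :
    ∃ y : HypSpace d, y.vec = Real.cosh s • x.vec + Real.sinh s • (w - lam • x.vec) ∧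
      mink y.vec w = Real.sinh s - lam * Real.cosh s := by
  have hxw : mink x.vec w = -lam := hx
  have hwx : mink w x.vec = -lam := by rw [mink_comm, hxw]
  have hcs := Real.cosh_sq s
  obtain ⟨y, hy⟩ := exists_hypSpace_vec_eq
    (x := Real.cosh s • x.vec + Real.sinh s • (w - lam • x.vec)) (p := x)
    (by
      simp only [mink_add_left, mink_add_right, mink_sub_left, mink_sub_right, mink_smul_left,
        mink_smul_right, hxw, hwx, hw, x.mink_self]
      linear_combination -hcs)
    (by
      simp only [mink_add_left, mink_sub_left, mink_smul_left, hwx, x.mink_self]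
      linarith [Real.cosh_pos s])
  refine ⟨y, hy, ?_⟩
  simp only [hy, mink_add_left, mink_sub_left, mink_smul_left, hxw, hw]
  ring

/-- The set is the continuous image of a convex set, chart domain times J, under the normal flow.
The foot of the perpendicular provides surjectivity. -/
theorem isPreconnected_signed_distance_mem (hd : 2 ≤ d) {w : Mink d} {lam : ℝ} (h0 : 0 ≤ lam)
    (h1 : lam ≤ 1) (hw : mink w w = 1 - lam ^ 2) {p : HypSpace d} (hp : p ∈ umbilicLevel w lam)
    {J : Set ℝ} (hJ : Convex ℝ J) :
    IsPreconnected {o : HypSpace d | ∃ s ∈ J, mink o.vec w = Real.sinh s - lam * Real.cosh s} := by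
  have hlam : lam ^ 2 ≤ 1 := by nlinarith
  obtain ⟨q, n, rfl, hn, hnq, -⟩ := exists_foot (s := 0) h0 h1 hw (o := p)
    (by rw [show mink p.vec w = -lam from hp]; simp)
  obtain ⟨F⟩ := exists_tangentFrame hd q hn hnq
  set w := n + lam • q.vec
  have hdom : IsPreconnected (TangentFrame.stereoDomain d lam ×ˢ J) :=
    ((TangentFrame.convex_stereoDomain hlam).prod hJ).isPreconnected
  have := Subtype.preconnectedSpace hdom
  choose g hg hgw using fun a : TangentFrame.stereoDomain d lam ×ˢ J =>
    exists_normal_flow hw (F.stereo_mem a.2.1) a.1.2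
  have hgc : Continuous g := by
    rw [HypSpace.continuous_iff]
    simp only [hg]
    have h2 : Continuous fun a : TangentFrame.stereoDomain d lam ×ˢ J =>
        (F.stereo lam a.1.1).vec :=
      HypSpace.continuous_vec.comp (F.continuousOn_stereo.comp_continuous
        (by fun_prop) fun a => a.2.1)
    have h3 : Continuous fun a : TangentFrame.stereoDomain d lam ×ˢ J => Real.cosh a.1.2 := by
      fun_prop
    have h4 : Continuous fun a : TangentFrame.stereoDomain d lam ×ˢ J => Real.sinh a.1.2 := by
      fun_prop
    exact (h3.smul h2).add (h4.smul (continuous_const.sub (h2.const_smul lam)))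
  convert isPreconnected_range hgc using 1
  ext o
  constructor
  · rintro ⟨s, hs, ho⟩
    obtain ⟨x, n', hwx, -, hnx, hox⟩ := exists_foot h0 h1 hw ho
    have hx : x ∈ umbilicLevel w lam := by
      rw [umbilicLevel, mem_ofPred_eq, hwx, mink_add_right, mink_comm _ n', hnx, mink_smul_right,
        x.mink_self]
      ring
    have hx' := F.chart_mem_and_stereoVec_chart hlam hx
    refine ⟨⟨(F.chart lam x.vec, s), hx'.1, hs⟩, HypSpace.ext ?_⟩
    rw [hg, F.stereo_chart hlam hx, hox, hwx, add_sub_cancel_right]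
  · rintro ⟨a, rfl⟩
    exact ⟨a.1.2, a.2.2, hgw a⟩

theorem isPreconnected_sides (hd : 2 ≤ d) {w : Mink d} {lam : ℝ} (h0 : 0 ≤ lam) (h1 : lam ≤ 1)
    (hw : mink w w = 1 - lam ^ 2) {p : HypSpace d} (hp : p ∈ umbilicLevel w lam) :
    IsPreconnected {o : HypSpace d | -lam < mink o.vec w} ∧
      IsPreconnected {o : HypSpace d | mink o.vec w < -lam} := by
  constructor
  · convert isPreconnected_signed_distance_mem hd h0 h1 hw hp (convex_Ioi 0) using 1
    ext o
    constructor
    · intro ho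
      obtain ⟨s, hs⟩ := exists_signed_distance h0 h1 hw hp o
      exact ⟨s, (neg_lt_sinh_sub_iff h0 h1).1.1 (hs ▸ ho), hs⟩
    · rintro ⟨s, hs, ho⟩
      rw [mem_ofPred_eq, ho]
      exact (neg_lt_sinh_sub_iff h0 h1).1.2 hs
  · convert isPreconnected_signed_distance_mem hd h0 h1 hw hp (convex_Iio 0) using 1
    ext o
    constructor
    · intro ho
      obtain ⟨s, hs⟩ := exists_signed_distance h0 h1 hw hp o
      exact ⟨s, (neg_lt_sinh_sub_iff h0 h1).2.1 (hs ▸ ho), hs⟩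
    · rintro ⟨s, hs, ho⟩
      rw [mem_ofPred_eq, ho]
      exact (neg_lt_sinh_sub_iff h0 h1).2.2 hs

/-! ### Which side is convex -/

theorem HypSpace.exists_midpoint (x y : HypSpace d) :
    ∃ z : HypSpace d, z.vec = (√(2 + 2 * -mink x.vec y.vec))⁻¹ • (x.vec + y.vec) ∧
      dist x z + dist z y = dist x y := by
  set c := -mink x.vec y.vec with hc
  have hc1 : 1 ≤ c := x.one_le_neg_mink y
  have hxy : mink x.vec y.vec = -c := by rw [hc, neg_neg]
  have hyx : mink y.vec x.vec = -c := by rw [mink_comm, hxy]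
  set r := √(2 + 2 * c) with hr
  have hr0 : 0 < r := Real.sqrt_pos.2 (by linarith)
  have hr2 : r ^ 2 = 2 + 2 * c := Real.sq_sqrt (by linarith)
  obtain ⟨z, hz⟩ := exists_hypSpace_vec_eq (x := r⁻¹ • (x.vec + y.vec)) (p := x)
    (by
      simp only [mink_add_left, mink_add_right, mink_smul_left, mink_smul_right, hxy, hyx,
        x.mink_self, y.mink_self]
      field_simp
      linarith)
    (by
      simp only [mink_add_left, mink_smul_left, hyx, x.mink_self]
      refine mul_neg_of_pos_of_neg (inv_pos.2 hr0) (by linarith))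
  have h1 : -mink x.vec z.vec = r / 2 := by
    simp only [hz, mink_add_right, mink_smul_right, hxy, x.mink_self]
    field_simp
    linarith
  have h2 : -mink z.vec y.vec = r / 2 := by
    simp only [hz, mink_add_left, mink_smul_left, hxy, y.mink_self]
    field_simp
    linarith
  refine ⟨z, hz, ?_⟩
  have h3 : dist z y = dist x z := by rw [HypSpace.dist_def, HypSpace.dist_def, h1, h2]
  have h4 : Real.cosh (2 * dist x z) = c := by
    rw [Real.cosh_two_mul, Real.sinh_sq, HypSpace.cosh_dist, h1]
    linear_combination (1 / 2) * hr2
  rw [h3, HypSpace.dist_def x y, ← hc, ← h4, Real.arcosh_cosh (by positivity)]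
  ring

/-- The midpoint of two distinct points of the level set has product -2λ / r with w, where r > 2, so
it lies strictly on the other side. This persists by continuity when both points are pushed slightly
into the side by the normal flow with s < 0. -/
theorem not_geodesicallyConvex_side (hd : 2 ≤ d) {w : Mink d} {lam : ℝ} (h0 : 0 < lam)
    (h1 : lam ≤ 1) (hw : mink w w = 1 - lam ^ 2) {p : HypSpace d} (hp : p ∈ umbilicLevel w lam) :
    ¬ GeodesicallyConvex {o : HypSpace d | mink o.vec w < -lam} := by
  intro hconv
  obtain ⟨q, n, rfl, hn, hnq, -⟩ := exists_foot (s := 0) h0.le h1 hw (o := p)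
    (by rw [show mink p.vec w = -lam from hp]; simp)
  obtain ⟨F⟩ := exists_tangentFrame hd q hn hnq
  set w := n + lam • q.vec
  set a : EuclideanSpace ℝ (Fin (d - 1)) := EuclideanSpace.single ⟨0, by omega⟩ 1 with ha
  have han : ‖a‖ = 1 := by simp [ha]
  have haD : a ∈ TangentFrame.stereoDomain d lam := by
    rw [TangentFrame.stereoDomain, mem_ofPred_eq, han]
    nlinarith
  set b := F.stereo lam a with hb
  have hbL : b ∈ umbilicLevel w lam := F.stereo_mem haD
  have hqL : q ∈ umbilicLevel w lam := F.base_mem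
  have hqb : 1 < -mink q.vec b.vec := by
    rw [mink_comm, hb, F.stereo_vec haD, F.mink_stereoVec_base, TangentFrame.height, han]
    have := TangentFrame.factor_pos haD
    linarith
  choose X hX hXw using exists_normal_flow hw hqL
  choose Y hY hYw using exists_normal_flow hw hbL
  have hcont : Continuous fun s => lam * √(2 + 2 * -mink (X s).vec (Y s).vec) -
      2 * (lam * Real.cosh s - Real.sinh s) := by
    have h2 : Continuous fun s => (X s).vec := by
      simp only [hX]
      fun_prop
    have h3 : Continuous fun s => (Y s).vec := by
      simp only [hY]
      fun_prop
    have h4 := Continuous.mink h2 h3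
    fun_prop
  have hpos : 0 < lam * √(2 + 2 * -mink (X 0).vec (Y 0).vec) -
      2 * (lam * Real.cosh 0 - Real.sinh 0) := by
    have hX0 : (X 0).vec = q.vec := by simp [hX]
    have hY0 : (Y 0).vec = b.vec := by simp [hY]
    rw [hX0, hY0, Real.cosh_zero, Real.sinh_zero]
    have : 2 < √(2 + 2 * -mink q.vec b.vec) := Real.lt_sqrt_of_sq_lt (by linarith)
    nlinarith
  obtain ⟨s, hs, hs0⟩ : ∃ s, 0 < lam * √(2 + 2 * -mink (X s).vec (Y s).vec) -
      2 * (lam * Real.cosh s - Real.sinh s) ∧ s < 0 :=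
    (((hcont.tendsto 0).eventually_const_lt hpos).filter_mono nhdsWithin_le_nhds |>.and
      (self_mem_nhdsWithin : ∀ᶠ s in 𝓝[<] (0 : ℝ), s ∈ Iio 0)).exists
  have hside := (neg_lt_sinh_sub_iff h0.le h1).2.2 hs0
  obtain ⟨z, hz, hzd⟩ := HypSpace.exists_midpoint (X s) (Y s)
  have hzside : mink z.vec w < -lam := hconv (X s) (by rw [mem_ofPred_eq, hXw]; exact hside) (Y s)
    (by rw [mem_ofPred_eq, hYw]; exact hside) z hzd
  have hr0 : 0 < √(2 + 2 * -mink (X s).vec (Y s).vec) :=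
    Real.sqrt_pos.2 (by linarith [(X s).one_le_neg_mink (Y s)])
  rw [hz, mink_smul_left, mink_add_left, hXw, hYw, inv_mul_lt_iff₀ hr0] at hzside
  linarith

/-- The convex side of an umbilic level set with positive normal curvature. -/
theorem convexSide_eq (hd : 2 ≤ d) {w : Mink d} {lam : ℝ} (h0 : 0 < lam) (h1 : lam ≤ 1)
    (hw : mink w w = 1 - lam ^ 2) {p : HypSpace d} (hp : p ∈ umbilicLevel w lam)
    {C : Set (HypSpace d)} (hC : IsConvexSide (umbilicLevel w lam) C) :
    C = {o : HypSpace d | -lam < mink o.vec w} := by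
  obtain ⟨⟨x, hx, hCx⟩, hconv⟩ := hC
  obtain ⟨hA, hB⟩ := isPreconnected_sides hd h0.le h1 hw hp
  have hcont : Continuous fun y : HypSpace d => mink y.vec w :=
    Continuous.mink HypSpace.continuous_vec continuous_const
  have hCpre : IsPreconnected C := hCx ▸ isPreconnected_connectedComponentIn
  have hCsub : C ⊆ (umbilicLevel w lam)ᶜ := hCx ▸ connectedComponentIn_subset _ _
  have hxC : x ∈ C := hCx ▸ mem_connectedComponentIn hx
  -- By the intermediate value theorem a connected set meeting both sides meets the level set. Each
  -- side being connected, C is exactly one of them.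
  have hsep : ∀ y ∈ C, ∀ z ∈ C, mink y.vec w < -lam → -lam < mink z.vec w → False := by
    intro y hy z hz hyw hzw
    obtain ⟨v, hv, hvw⟩ := hCpre.intermediate_value hy hz hcont.continuousOn ⟨hyw.le, hzw.le⟩
    exact hCsub hv hvw
  rcases lt_or_gt_of_ne (show mink x.vec w ≠ -lam from hx) with hlt | hgt
  · refine absurd hconv ?_
    convert not_geodesicallyConvex_side hd h0 h1 hw hp
    refine Subset.antisymm (fun y hy => ?_) ?_
    · rcases lt_or_gt_of_ne (show mink y.vec w ≠ -lam from hCsub hy) with h | h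
      · exact h
      · exact (hsep x hxC y hy hlt h).elim
    · rw [hCx]
      exact hB.subset_connectedComponentIn hlt fun y hy h => (ne_of_lt hy) h
  · refine Subset.antisymm (fun y hy => ?_) ?_
    · rcases lt_or_gt_of_ne (show mink y.vec w ≠ -lam from hCsub hy) with h | h
      · exact (hsep y hy x hxC h hgt).elim
      · exact h
    · rw [hCx]
      exact hA.subset_connectedComponentIn hgt fun y hy h => (ne_of_gt hy) h

end Hyperbolic

end

theorem proposition4p1 (d : ℕ) (hd : 2 ≤ d) (lam : ℝ) (hlam : lam ∈ Set.Icc (0 : ℝ) 1)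
    (H C : Set (HypSpace d)) (hH : IsLambdaGeodesicHyperplane lam H) (hC : IsConvexSide H C)
    (o : HypSpace d) (R : ℝ) (hR : 0 < R) (s : ℝ) (hs : signedDist H C o = s) :
    ((H ∩ Metric.closedBall o R).Nonempty ↔ |s| ≤ R) ∧
    (|s| ≤ R → IsIntrinsicBall H (H ∩ Metric.closedBall o R)) ∧
    (|s| ≤ R → lam = 1 →
      Measure.euclideanHausdorffMeasure (d - 1) (H ∩ Metric.closedBall o R) =
        ENNReal.ofReal (ballVolume (d - 1) *
          (2 * Real.exp s * (Real.cosh R - Real.cosh s)) ^ (((d : ℝ) - 1) / 2))) ∧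
    (|s| ≤ R → lam < 1 →
      Measure.euclideanHausdorffMeasure (d - 1) (H ∩ Metric.closedBall o R) =
        ENNReal.ofReal (ballSurface (d - 1) / √(1 - lam ^ 2) ^ (d - 1) *
          ∫ u in (0 : ℝ)..rho lam s R, Real.sinh u ^ (d - 2))) := by
  obtain ⟨h0, h1⟩ := hlam
  obtain ⟨p, w, hp, hw, rfl⟩ := hH.exists_eq_umbilicLevel hd h0 h1
  obtain ⟨s', hs'⟩ := exists_signed_distance h0 h1 hw hp o
  have hdist : Metric.infDist o (umbilicLevel w lam) = |s'| := by
    obtain ⟨q, n, rfl, hn, hnq, hoq⟩ := exists_foot h0 h1 hw hs'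
    obtain ⟨F⟩ := exists_tangentFrame hd q hn hnq
    exact F.infDist_umbilicLevel h0 h1 hoq
  rw [Hyperbolic.signedDist, hdist] at hs
  rcases h0.eq_or_lt with rfl | hpos
  · have hcases : s = s' ∨ s = -s' := by
      rw [← hs]
      split_ifs
      · exact abs_choice s'
      · rcases abs_choice s' with h | h <;> rw [h] <;> simp
    rcases hcases with rfl | rfl
    · exact umbilicLevel_inter_closedBall hd h0 h1 hw hs' hR
    · have hneg : umbilicLevel w 0 = umbilicLevel (-w) 0 := by
        ext x
        simp [umbilicLevel, mink_neg_right]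
      rw [hneg]
      refine umbilicLevel_inter_closedBall hd h0 h1 ?_ ?_ hR
      · rw [mink_neg_left, mink_neg_right, neg_neg, hw]
      · rw [mink_neg_right, hs', Real.sinh_neg]
        ring
  -- For λ > 0 the side C is determined, and o lies in it exactly when s' > 0.
  · have hCeq := convexSide_eq hd hpos h1 hw hp hC
    have hsign := (neg_lt_sinh_sub_iff (s := s') h0 h1).1
    rw [← hs', show (-lam < mink o.vec w) ↔ o ∈ C by rw [hCeq]; rfl] at hsign
    have : s = s' := by
      rw [← hs]
      split_ifs with h
      · exact abs_of_pos (hsign.1 h)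
      · rw [abs_of_nonpos (not_lt.1 fun h' => h (hsign.2 h')), neg_neg]
    rw [this]
    exact umbilicLevel_inter_closedBall hd h0 h1 hw hs' hR
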